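/- **Setting.** Let $f:\mathbb R\to[0,\infty)$ be in $L^1(\mathbb R)\cap L^2(\mathbb R)$ and, for an integer $n\ge1$, let $N$ be a Poisson process on $\mathbb R$ with mean measure $n f(x)\,dx$ (a random countable set of points such that the number of points in a measurable set $A$ is Poisson with parameter $n\int_A f$, and the numbers of points in disjoint sets are independent); write $\int g\,dN=\sum_{T\in N}g(T)$. Let $\phi=1_{[0,1]}$, let $\psi$ be a compactly supported piecewise constant function, and let $\tilde\phi,\tilde\psi\in L^2(\mathbb R)$ be compactly supported, such that, with $\phi_k(x)=\phi(x-k)$, $\psi_{j,k}(x)=2^{j/2}\psi(2^jx-k)$ and $\tilde\phi_k,\tilde\psi_{j,k}$ defined in the same way, for all integers $j,j'\ge0$ and $k,k'\in\mathbb Z$, $$\int\psi_{j,k}\tilde\phi_{k'}=\int\phi_k\tilde\psi_{j',k'}=0,\qquad \int\phi_k\tilde\phi_{k'}=1_{k=k'},\qquad \int\psi_{j,k}\tilde\psi_{j',k'}=1_{j=j',\,k=k'}$$ (this covers the biorthogonal spline wavelet bases of any regularity with $\phi=1_{[0,1]}$, and the Haar basis). Let $\Lambda=\{(j,k):j\ge-1,\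 k\in\mathbb Z\}$, and for $\lambda=(j,k)\in\Lambda$ put $\varphi_\lambda=\phi_k$, $\tilde\varphi_\lambda=\tilde\phi_k$ if $j=-1$ and $\varphi_\lambda=\psi_{j,k}$, $\tilde\varphi_\lambda=\tilde\psi_{j,k}$ if $j\ge0$. Set $$\beta_\lambda=\int f\varphi_\lambda,\qquad V_{\lambda,n}=\frac1n\int\varphi_\lambda^2 f,\qquad \|g\|_\varphi^2=\sum_{\lambda\in\Lambda}\Big(\int g\,\varphi_\lambda\Big)^2,$$ $$\hat\beta_\lambda=\frac1n\int\varphi_\lambda\,dN,\qquad \hat V_{\lambda,n}=\int\frac{\varphi_\lambda^2}{n^2}\,dN,$$ and, for $\gamma>1$, $$\tilde V_{\lambda,n}=\hat V_{\lambda,n}+\sqrt{2\gamma\ln n\,\hat V_{\lambda,n}\frac{\|\varphi_\lambda\|_\infty^2}{n^2}}+3\gamma\ln n\,\frac{\|\varphi_\lambda\|_\infty^2}{n^2},\qquad \eta_{\lambda,\gamma}=\sqrt{2\gamma\ln n\,\tilde V_{\lambda,n}}+\frac{\gamma\ln n}{3n}\|\varphi_\lambda\|_\infty .$$ **Theorem.**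 Fix constants $c\ge1$, $c'\in\mathbb R$ and $\gamma>c$. For every integer $n\ge2$ (and also for $n=1$ if $c'=0$, with $0^0=1$), let $j_0=j_0(n)\in\mathbb Z$ be the integer with $2^{j_0}\le n^c(\ln n)^{c'}<2^{j_0+1}$, let $\Gamma_n=\{(j,k)\in\Lambda: j\le j_0\}$, and let $$\tilde f_{n,\gamma}=\sum_{\lambda\in\Gamma_n}\hat\beta_\lambda 1_{|\hat\beta_\lambda|\ge\eta_{\lambda,\gamma}}\,\tilde\varphi_\lambda .$$ Then $$\mathbb E\|\tilde f_{n,\gamma}-f\|_\varphi^2\le C_1\Big[\sum_{\lambda\in\Gamma_n}\min(\beta_\lambda^2,V_{\lambda,n}\ln n)+\sum_{\lambda\notin\Gamma_n}\beta_\lambda^2\Big]+\frac{C_2}{n},$$ where $C_1>0$ depends only on $\gamma$ and on the wavelet system, and $C_2>0$ depends only on $\gamma$, $\|f\|_{L^1}$, $c$, $c'$ and the wavelet system. -/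

import Mathlib

open MeasureTheory ProbabilityTheory
open scoped ENNReal

noncomputable section

namespace PoissonWavelet

/-! ### Poisson processes on the real line -/

/-- The number of points of the random set `N` that lie in `A`. -/
def pointCount {Ω : Type*} (N : Ω → Set ℝ) (A : Set ℝ) (ω : Ω) : ℕ∞ :=
  (N ω ∩ A).encard

/-- `N` is a Poisson process on `ℝ` with mean measure `μ`: a random countable subset of `ℝ` such
that the number of points in a measurable set `A` is a random variable with the Poisson law of
parameter `μ A` (equal to `∞` almost surely if `μ A = ∞`), and the numbers of points in finitely
many pairwise disjoint measurable sets are independent. -/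
structure IsPoissonProcess {Ω : Type*} [MeasurableSpace Ω] (P : Measure Ω) (N : Ω → Set ℝ)
    (μ : Measure ℝ) : Prop where
  countable : ∀ ω, (N ω).Countable
  measurable_count : ∀ A : Set ℝ, MeasurableSet A → Measurable (pointCount N A)
  law_count : ∀ A : Set ℝ, MeasurableSet A → μ A ≠ ∞ →
    P.map (pointCount N A) =
      (poissonMeasure (μ A).toNNReal).map (fun k : ℕ => (k : ℕ∞))
  count_top : ∀ A : Set ℝ, MeasurableSet A → μ A = ∞ → ∀ᵐ ω ∂P, pointCount N A ω = ⊤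
  indep_count : ∀ (m : ℕ) (A : Fin m → Set ℝ), (∀ i, MeasurableSet (A i)) →
    Pairwise (fun i j => Disjoint (A i) (A j)) → iIndepFun (fun i => pointCount N (A i)) P

/-- `∫ g dN = ∑_{T ∈ N} g T` for a set `N` of points (almost surely finite when the mean measure
of the process is finite). -/
def pointSum (N : Set ℝ) (g : ℝ → ℝ) : ℝ := ∑' T : N, g T

/-! ### Biorthogonal wavelets -/

/-- The translate `g (x - k)`. -/
def translate (g : ℝ → ℝ) (k : ℤ) (x : ℝ) : ℝ := g (x - k)

/-- The function `2 ^ (j / 2) g (2 ^ j x - k)`. -/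
def dilate (g : ℝ → ℝ) (j k : ℤ) (x : ℝ) : ℝ :=
  (2 : ℝ) ^ ((j : ℝ) / 2) * g ((2 : ℝ) ^ j * x - k)

/-- The analysis scaling function `φ = 1_[0,1]`. -/
def phi : ℝ → ℝ := (Set.Icc (0 : ℝ) 1).indicator (fun _ => 1)

/-- `g` is piecewise constant: there are finitely many breakpoints, and `g` is constant on every
interval that contains none of them. -/
def IsPiecewiseConstant (g : ℝ → ℝ) : Prop :=
  ∃ S : Finset ℝ, ∀ x y : ℝ, x ≤ y → (∀ s ∈ S, s ∉ Set.Icc x y) → g x = g y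

/-- A biorthogonal wavelet system with analysis scaling function `φ = 1_[0,1]`, a compactly
supported piecewise constant analysis wavelet `ψ`, and compactly supported reconstruction
functions `φt`, `ψt` (for `φ̃`, `ψ̃`) in `L²`. Neither smoothness of the reconstruction functions
nor vanishing moments of `ψ` are required, so that the spline systems of every regularity and the
Haar system are all included. -/
structure BiorthogonalWavelets where
  ψ : ℝ → ℝ
  φt : ℝ → ℝ
  ψt : ℝ → ℝ
  compact_ψ : HasCompactSupport ψ
  piecewise_ψ : IsPiecewiseConstant ψ
  compact_φt : HasCompactSupport φt
  compact_ψt : HasCompactSupport ψt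
  memLp_φt : MemLp φt 2 volume
  memLp_ψt : MemLp ψt 2 volume
  biorth_ψ_φt : ∀ j k k' : ℤ, 0 ≤ j →
    ∫ x, dilate ψ j k x * translate φt k' x = 0
  biorth_φ_ψt : ∀ j' k k' : ℤ, 0 ≤ j' →
    ∫ x, translate phi k x * dilate ψt j' k' x = 0
  biorth_φ_φt : ∀ k k' : ℤ,
    ∫ x, translate phi k x * translate φt k' x = if k = k' then 1 else 0
  biorth_ψ_ψt : ∀ j j' k k' : ℤ, 0 ≤ j → 0 ≤ j' →
    ∫ x, dilate ψ j k x * dilate ψt j' k' x = if j = j' ∧ k = k' then 1 else 0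

/-- The index set `Λ = {(j, k) : j ≥ -1, k ∈ ℤ}`. -/
abbrev WaveletIndex : Type := {l : ℤ × ℤ // -1 ≤ l.1}

/-- The set of indices `(j, k) ∈ Λ` with `j ≤ j₀`. -/
def levelsUpTo (j₀ : ℤ) : Set WaveletIndex := {l | l.1.1 ≤ j₀}

/-- The supremum norm (for Lebesgue measure) of `g`. -/
def supNorm (g : ℝ → ℝ) : ℝ := (eLpNorm g ∞ volume).toReal

namespace BiorthogonalWavelets

/-- The analysis function `φ_λ`. -/
def analysis (W : BiorthogonalWavelets) (l : WaveletIndex) : ℝ → ℝ :=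
  if l.1.1 = -1 then translate phi l.1.2 else dilate W.ψ l.1.1 l.1.2

/-- The reconstruction function `φ̃_λ`. -/
def reconstruction (W : BiorthogonalWavelets) (l : WaveletIndex) : ℝ → ℝ :=
  if l.1.1 = -1 then translate W.φt l.1.2 else dilate W.ψt l.1.1 l.1.2

/-- The coefficient `∫ g φ_λ` of a function `g`; for the intensity `f` it is `β_λ`. -/
def coeff (W : BiorthogonalWavelets) (g : ℝ → ℝ) (l : WaveletIndex) : ℝ :=
  ∫ x, g x * W.analysis l x

/-- The squared norm `‖g‖_φ² = ∑_λ (∫ g φ_λ)²`, as an extended nonnegative number. -/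
def normSq (W : BiorthogonalWavelets) (g : ℝ → ℝ) : ℝ≥0∞ :=
  ∑' l : WaveletIndex, ENNReal.ofReal (W.coeff g l ^ 2)

/-- `σ_λ² = ∫ φ_λ² f`. -/
def sigmaSq (W : BiorthogonalWavelets) (f : ℝ → ℝ) (l : WaveletIndex) : ℝ :=
  ∫ x, W.analysis l x ^ 2 * f x

/-- `V_{λ,n} = σ_λ² / n`, the variance of `β̂_λ`. -/
def variance (W : BiorthogonalWavelets) (f : ℝ → ℝ) (n : ℕ) (l : WaveletIndex) : ℝ :=
  W.sigmaSq f l / n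

/-! ### The thresholding estimator, as a function of the observed point set `N` -/

/-- `β̂_λ = (1 / n) ∫ φ_λ dN`. -/
def betaHat (W : BiorthogonalWavelets) (n : ℕ) (N : Set ℝ) (l : WaveletIndex) : ℝ :=
  1 / n * pointSum N (W.analysis l)

/-- `V̂_{λ,n} = ∫ φ_λ² / n² dN`. -/
def varHat (W : BiorthogonalWavelets) (n : ℕ) (N : Set ℝ) (l : WaveletIndex) : ℝ :=
  pointSum N (fun x => W.analysis l x ^ 2 / (n : ℝ) ^ 2)

/-- `Ṽ_{λ,n} = V̂_{λ,n} + √(2 γ ln n V̂_{λ,n} ‖φ_λ‖_∞² / n²) + 3 γ ln n ‖φ_λ‖_∞² / n²`. -/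
def varTilde (W : BiorthogonalWavelets) (γ : ℝ) (n : ℕ) (N : Set ℝ) (l : WaveletIndex) : ℝ :=
  W.varHat n N l
    + Real.sqrt (2 * γ * Real.log n * W.varHat n N l
        * (supNorm (W.analysis l) ^ 2 / (n : ℝ) ^ 2))
    + 3 * γ * Real.log n * (supNorm (W.analysis l) ^ 2 / (n : ℝ) ^ 2)

/-- The random threshold
`η_{λ,γ} = √(2 γ ln n Ṽ_{λ,n}) + γ ln n / (3 n) ‖φ_λ‖_∞`. -/
def threshold (W : BiorthogonalWavelets) (γ : ℝ) (n : ℕ) (N : Set ℝ) (l : WaveletIndex) : ℝ :=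
  Real.sqrt (2 * γ * Real.log n * W.varTilde γ n N l)
    + γ * Real.log n / (3 * n) * supNorm (W.analysis l)

open Classical in
/-- `β̃_λ = β̂_λ 1_{|β̂_λ| ≥ η_{λ,γ}}`. -/
def betaTilde (W : BiorthogonalWavelets) (γ : ℝ) (n : ℕ) (N : Set ℝ) (l : WaveletIndex) : ℝ :=
  if W.threshold γ n N l ≤ |W.betaHat n N l| then W.betaHat n N l else 0

/-- The estimator `f̃_{n,γ} = ∑_{λ ∈ Γ} β̃_λ φ̃_λ`. For a finite point set `N` and for
`Γ = {j ≤ j₀}` only finitely many terms are nonzero. -/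
def estimator (W : BiorthogonalWavelets) (γ : ℝ) (n : ℕ) (Γ : Set WaveletIndex) (N : Set ℝ)
    (x : ℝ) : ℝ :=
  ∑' l : Γ, W.betaTilde γ n N l * W.reconstruction l x

/-- The risk `E ‖f̃_{n,γ} - f‖_φ²`. -/
def risk (W : BiorthogonalWavelets) (γ : ℝ) (n : ℕ) (Γ : Set WaveletIndex) (f : ℝ → ℝ)
    {Ω : Type*} [MeasurableSpace Ω] (P : Measure Ω) (N : Ω → Set ℝ) : ℝ≥0∞ :=
  ∫⁻ ω, W.normSq (fun x => W.estimator γ n Γ (N ω) x - f x) ∂P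

/-- `∑_{λ ∈ Γ} min(β_λ², V_{λ,n} ln n) + ∑_{λ ∉ Γ} β_λ²`. -/
def oracleBound (W : BiorthogonalWavelets) (n : ℕ) (Γ : Set WaveletIndex) (f : ℝ → ℝ) : ℝ≥0∞ :=
  (∑' l : Γ, ENNReal.ofReal (min (W.coeff f l ^ 2) (W.variance f n l * Real.log n)))
    + ∑' l : (Γᶜ : Set WaveletIndex), ENNReal.ofReal (W.coeff f l ^ 2)

end BiorthogonalWavelets

end PoissonWavelet

end

noncomputable section

set_option linter.unusedSectionVars false

namespace PoissonWavelet

open scoped NNReal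

/-! ### Exponential moments of Poisson variables -/

/-! Biorthogonality reduces the risk to scalar problems: the coefficient of the estimator minus f at
λ is β̃_λ − β_λ inside Γ and −β_λ outside (`coeff_estimator_sub`). The terms outside Γ are the last
sum of the oracle bound, so it remains to bound E(β̃_λ − β_λ)² for each λ with remainders summable
over the infinitely many translates.

Multiply by n and write g = φ_λ, μ = n f dx, m = ∫ g dμ, v = ∫ g² dμ, b = ‖g‖_∞, q = μ(supp g), L =
ln n. As g takes finitely many values, ∫ g dN is a finite combination of independent Poisson
variables, so its Laplace transform is explicit and Bernstein's inequality holds for g and for g².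
Also, |g| is comparable to b on its support, uniformly in λ (`exists_sq_lower_bound`), so κb²q ≤ v ≤
b²q, while Cauchy–Schwarz gives m² ≤ qv.

The core is `lintegral_coeffLoss_le_oracle`: the expected loss is at most a constant times min(m²,
vL), plus a constant times b²qL e^{−γ'L}, for a fixed γ' in (c, γ). If 8q ≤ L, then m² ≤ vL, and
passing the threshold requires at least 2γL points in the support, a rare event with an expected
cost proportional to q. If 8q > L, then v is at least of order b²L, so the squared threshold has
mean of order vL. A coefficient with m² ≥ δ²vL then satisfies v ≤ m², and variance plus bias
suffices. A smaller one passes the threshold only if Bernstein's bound fails at level γ'L for the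
sum or at level γL for the empirical variance; the gap between √(2γ) and √(2γ') pays for its mean.

The supports at one level overlap boundedly, so b²q sums to order 2^{j₀} n‖f‖₁
(`exists_tsum_supNorm_sq_le`). After division by n², the remainder is of order n^{c−γ'}(ln
n)^{c'+1}/n, which is O(1/n) since γ' > c. The finitely many small n are covered by
`lintegral_coeffLoss_le`, whose remainder 3v is affordable there. -/

lemma hasSum_exp_mul_poisson (r : ℝ≥0) (t : ℝ) :
    HasSum (fun k : ℕ => Real.exp (-r) * (r : ℝ) ^ k / (k.factorial : ℝ) * Real.exp (t * k))
      (Real.exp (r * (Real.exp t - 1))) := by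
  have h := (NormedSpace.expSeries_div_hasSum_exp ((r : ℝ) * Real.exp t)).mul_left
    (Real.exp (-r))
  rw [← Real.exp_eq_exp_ℝ, ← Real.exp_add] at h
  convert! h using 1
  · ext k
    rw [mul_pow, ← Real.exp_nat_mul]
    ring_nf
  · ring_nf

lemma integrable_exp_mul_poissonMeasure (r : ℝ≥0) (t : ℝ) :
    Integrable (fun k : ℕ => Real.exp (t * k)) (poissonMeasure r) := by
  rw [integrable_poissonMeasure_iff]
  simpa [Real.norm_eq_abs, abs_of_pos (Real.exp_pos _)] using (hasSum_exp_mul_poisson r t).summable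

lemma mgf_poissonMeasure (r : ℝ≥0) (t : ℝ) :
    mgf (fun k : ℕ => (k : ℝ)) (poissonMeasure r) t = Real.exp (r * (Real.exp t - 1)) := by
  rw [mgf, integral_poissonMeasure]
  simpa using (hasSum_exp_mul_poisson r t).tsum_eq

/-! ### Sums of simple functions over a point set -/

/-- The number of points of `N` in `A` as a real number (`0` if it is infinite). -/
def realCount {Ω : Type*} (N : Ω → Set ℝ) (A : Set ℝ) (ω : Ω) : ℝ := ((pointCount N A ω).toNat : ℝ)

lemma pointSum_eq_sum_fiber {N : Set ℝ} (hN : N.Finite) (g : SimpleFunc ℝ ℝ) :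
    pointSum N g = ∑ v ∈ g.range, v * ((N ∩ g ⁻¹' {v}).encard.toNat : ℝ) := by
  classical
  have : Fintype N := hN.fintype
  rw [pointSum, tsum_fintype, ← Finset.sum_subtype (s := N.toFinset) (p := (· ∈ N))
    (by simp) (fun x => g x), ← Finset.sum_fiberwise_of_maps_to (t := g.range) (g := g) (by simp)]
  refine Finset.sum_congr rfl fun v _ => ?_
  have h1 : ∀ i ∈ N.toFinset.filter (fun i => g i = v), g i = v := by simp
  rw [Finset.sum_congr rfl h1, Finset.sum_const, nsmul_eq_mul, mul_comm]
  congr 2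
  rw [Set.encard_eq_coe_toFinset_card (N ∩ g ⁻¹' {v}), ENat.toNat_natCast]
  congr 1
  ext x
  simp

lemma integral_comp_simpleFunc (μ : Measure ℝ) [IsFiniteMeasure μ] (g : SimpleFunc ℝ ℝ)
    (h : ℝ → ℝ) :
    ∫ x, h (g x) ∂μ = ∑ v ∈ g.range, h v * μ.real (g ⁻¹' {v}) := by
  have h1 : ∀ x, h (g x) = ∑ v ∈ g.range, (g ⁻¹' {v}).indicator (fun _ => h v) x := by
    intro x
    rw [Finset.sum_eq_single (g x)]
    · simp
    · intro b _ hb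
      simp [Set.indicator, hb.symm]
    · simp
  simp_rw [h1]
  rw [integral_finsetSum]
  · refine Finset.sum_congr rfl fun v _ => ?_
    rw [integral_indicator_const _ (g.measurableSet_fiber v), smul_eq_mul, mul_comm]
  · intro v _
    exact (integrable_const _).indicator (g.measurableSet_fiber v)

lemma integrable_comp_simpleFunc (μ : Measure ℝ) [IsFiniteMeasure μ] (g : SimpleFunc ℝ ℝ)
    (h : ℝ → ℝ) : Integrable (fun x => h (g x)) μ :=
  (g.map h).integrable_of_isFiniteMeasure

/-! ### Laplace transform and moments of Poisson sums -/

namespace IsPoissonProcess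

variable {Ω : Type*} [MeasurableSpace Ω] {P : Measure Ω} [IsProbabilityMeasure P]
  {N : Ω → Set ℝ} {μ : Measure ℝ} [IsFiniteMeasure μ]

lemma measurable_realCount (hN : IsPoissonProcess P N μ) {A : Set ℝ} (hA : MeasurableSet A) :
    Measurable (realCount N A) :=
  (measurable_of_countable (fun k : ℕ∞ => (k.toNat : ℝ))).comp (hN.measurable_count A hA)

lemma map_count_toNat (hN : IsPoissonProcess P N μ) {A : Set ℝ} (hA : MeasurableSet A) :
    P.map (fun ω => (pointCount N A ω).toNat) = poissonMeasure (μ A).toNNReal := by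
  have h1 := hN.law_count A hA (measure_ne_top μ A)
  have h2 : P.map (fun ω => (pointCount N A ω).toNat) =
      (P.map (pointCount N A)).map ENat.toNat := by
    rw [Measure.map_map (measurable_of_countable _) (hN.measurable_count A hA)]
    rfl
  rw [h2, h1, Measure.map_map (measurable_of_countable _) (measurable_of_countable _)]
  have : (ENat.toNat ∘ fun k : ℕ => (k : ℕ∞)) = id := by ext; simp
  rw [this, Measure.map_id]

lemma ae_finite (hN : IsPoissonProcess P N μ) : ∀ᵐ ω ∂P, (N ω).Finite := by
  have h1 := hN.law_count Set.univ .univ (measure_ne_top μ _)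
  have h2 : ∀ᵐ k ∂(P.map (pointCount N Set.univ)), k ≠ ⊤ := by
    rw [h1, ae_map_iff (measurable_of_countable _).aemeasurable (by measurability)]
    exact .of_forall fun k => ENat.natCast_ne_top k
  have h3 := ae_of_ae_map (hN.measurable_count _ .univ).aemeasurable h2
  filter_upwards [h3] with ω hω
  rw [pointCount, Set.inter_univ, Set.encard_ne_top_iff] at hω
  exact hω

lemma mgf_realCount (hN : IsPoissonProcess P N μ) {A : Set ℝ} (hA : MeasurableSet A) (t : ℝ) :
    mgf (realCount N A) P t = Real.exp (μ.real A * (Real.exp t - 1)) := by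
  have hm : Measurable (fun ω => (pointCount N A ω).toNat) :=
    (measurable_of_countable _).comp (hN.measurable_count A hA)
  have h := mgf_poissonMeasure (μ A).toNNReal t
  rw [← hN.map_count_toNat hA, mgf_map hm.aemeasurable (by fun_prop)] at h
  exact h

lemma integrable_exp_realCount (hN : IsPoissonProcess P N μ) {A : Set ℝ} (hA : MeasurableSet A)
    (t : ℝ) : Integrable (fun ω => Real.exp (t * realCount N A ω)) P := by
  have hm : Measurable (fun ω => (pointCount N A ω).toNat) :=
    (measurable_of_countable _).comp (hN.measurable_count A hA)
  have h := integrable_exp_mul_poissonMeasure (μ A).toNNReal t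
  rw [← hN.map_count_toNat hA, integrable_map_measure (by fun_prop) hm.aemeasurable] at h
  exact h

lemma pointSum_ae_eq (hN : IsPoissonProcess P N μ) (g : SimpleFunc ℝ ℝ) :
    (fun ω => pointSum (N ω) g) =ᵐ[P]
      ∑ v : g.range, fun ω => (v : ℝ) * realCount N (g ⁻¹' {(v : ℝ)}) ω := by
  filter_upwards [hN.ae_finite] with ω hω
  rw [pointSum_eq_sum_fiber hω g, Finset.sum_apply]
  exact (Finset.sum_coe_sort g.range
    (fun v => v * ((N ω ∩ g ⁻¹' {v}).encard.toNat : ℝ))).symm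

lemma aemeasurable_pointSum (hN : IsPoissonProcess P N μ) (g : SimpleFunc ℝ ℝ) :
    AEMeasurable (fun ω => pointSum (N ω) g) P := by
  refine AEMeasurable.congr ?_ (hN.pointSum_ae_eq g).symm
  refine Finset.aemeasurable_sum _ fun v _ => ?_
  exact ((hN.measurable_realCount (g.measurableSet_fiber v)).const_mul _).aemeasurable

/-- Level sets of distinct values are disjoint, so independence of counts applies directly. This is
what makes finitely valued integrands explicit, with no approximation argument. -/
lemma iIndepFun_fiberCount (hN : IsPoissonProcess P N μ) (g : SimpleFunc ℝ ℝ) :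
    iIndepFun (fun (v : g.range) ω => (v : ℝ) * realCount N (g ⁻¹' {(v : ℝ)}) ω) P := by
  let e := g.range.equivFin
  have h := hN.indep_count _ (fun i => g ⁻¹' {((e.symm i : g.range) : ℝ)})
    (fun i => g.measurableSet_fiber _) (by
      intro i j hij
      refine Set.disjoint_left.2 fun x hx hx' => hij ?_
      apply e.symm.injective
      apply Subtype.ext
      simp only [Set.mem_preimage, Set.mem_singleton_iff] at hx hx'
      rw [← hx, ← hx'])
  have h2 := (h.precomp e.injective).comp (fun (v : g.range) (k : ℕ∞) => (v : ℝ) * (k.toNat : ℝ))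
    (fun v => measurable_of_countable _)
  convert! h2 using 2 with v
  ext ω
  simp [realCount]

lemma integrable_exp_pointSum (hN : IsPoissonProcess P N μ) (g : SimpleFunc ℝ ℝ) (s : ℝ) :
    Integrable (fun ω => Real.exp (s * pointSum (N ω) g)) P := by
  have h := (hN.iIndepFun_fiberCount g).integrable_exp_mul_sum (t := s) (s := Finset.univ)
    (fun v => (hN.measurable_realCount (g.measurableSet_fiber v)).const_mul _)
    (fun v _ => by
      simp_rw [← mul_assoc]
      exact hN.integrable_exp_realCount (g.measurableSet_fiber v) _)
  refine h.congr ?_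
  filter_upwards [hN.pointSum_ae_eq g] with ω hω
  rw [hω]

lemma mgf_pointSum (hN : IsPoissonProcess P N μ) (g : SimpleFunc ℝ ℝ) (s : ℝ) :
    mgf (fun ω => pointSum (N ω) g) P s
      = Real.exp (∑ v ∈ g.range, (Real.exp (s * v) - 1) * μ.real (g ⁻¹' {v})) := by
  rw [mgf_congr (hN.pointSum_ae_eq g), (hN.iIndepFun_fiberCount g).mgf_sum
    (fun v => (hN.measurable_realCount (g.measurableSet_fiber v)).const_mul _)]
  rw [Real.exp_sum, ← Finset.prod_coe_sort g.range
    (fun v => Real.exp ((Real.exp (s * v) - 1) * μ.real (g ⁻¹' {v})))]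
  refine Finset.prod_congr rfl fun v _ => ?_
  have := hN.mgf_realCount (g.measurableSet_fiber v) (s * v)
  rw [mul_comm (μ.real _)] at this
  rw [← this, mgf, mgf]
  simp_rw [mul_assoc]

lemma mgf_pointSum' (hN : IsPoissonProcess P N μ) (g : SimpleFunc ℝ ℝ) (s : ℝ) :
    mgf (fun ω => pointSum (N ω) g) P s
      = Real.exp (∫ x, (Real.exp (s * g x) - 1) ∂μ) := by
  rw [hN.mgf_pointSum, integral_comp_simpleFunc μ g (fun v => Real.exp (s * v) - 1)]

lemma zero_mem_interior (hN : IsPoissonProcess P N μ) (g : SimpleFunc ℝ ℝ) :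
    0 ∈ interior (integrableExpSet (fun ω => pointSum (N ω) g) P) := by
  have : integrableExpSet (fun ω => pointSum (N ω) g) P = Set.univ :=
    Set.eq_univ_of_forall fun s => hN.integrable_exp_pointSum g s
  simp [this]

lemma memLp_pointSum (hN : IsPoissonProcess P N μ) (g : SimpleFunc ℝ ℝ) :
    MemLp (fun ω => pointSum (N ω) g) 2 P :=
  memLp_of_mem_interior_integrableExpSet (hN.zero_mem_interior g) 2

lemma hasDerivAt_cumulant (μ : Measure ℝ) (g : SimpleFunc ℝ ℝ) (s : ℝ) :
    HasDerivAt (fun s => ∑ v ∈ g.range, (Real.exp (s * v) - 1) * μ.real (g ⁻¹' {v}))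
      (∑ v ∈ g.range, Real.exp (s * v) * v * μ.real (g ⁻¹' {v})) s := by
  refine HasDerivAt.fun_sum fun v _ => ?_
  have := (((hasDerivAt_id s).mul_const v).exp.sub_const 1).mul_const (μ.real (g ⁻¹' {v}))
  simpa using this

lemma hasDerivAt_cumulant_deriv (μ : Measure ℝ) (g : SimpleFunc ℝ ℝ) (s : ℝ) :
    HasDerivAt (fun s => ∑ v ∈ g.range, Real.exp (s * v) * v * μ.real (g ⁻¹' {v}))
      (∑ v ∈ g.range, Real.exp (s * v) * v * v * μ.real (g ⁻¹' {v})) s := by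
  refine HasDerivAt.fun_sum fun v _ => ?_
  have := ((((hasDerivAt_id s).mul_const v).exp).mul_const v).mul_const (μ.real (g ⁻¹' {v}))
  simpa using this

lemma integral_pointSum (hN : IsPoissonProcess P N μ) (g : SimpleFunc ℝ ℝ) :
    ∫ ω, pointSum (N ω) g ∂P = ∫ x, g x ∂μ := by
  rw [← deriv_mgf_zero (hN.zero_mem_interior g), funext (hN.mgf_pointSum g),
    (hasDerivAt_cumulant μ g 0).exp.deriv, integral_comp_simpleFunc μ g (fun v => v)]
  simp

/-- The Laplace transform is exp Λ with Λ a finite sum of exponentials and Λ(0) = 0, so its second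
derivative at 0 is Λ''(0) + Λ'(0)². -/
lemma integral_pointSum_sq (hN : IsPoissonProcess P N μ) (g : SimpleFunc ℝ ℝ) :
    ∫ ω, pointSum (N ω) g ^ 2 ∂P = ∫ x, g x ^ 2 ∂μ + (∫ x, g x ∂μ) ^ 2 := by
  have h := iteratedDeriv_mgf_zero (hN.zero_mem_interior g) 2
  simp only [Pi.pow_apply] at h
  rw [← h, funext (hN.mgf_pointSum g), iteratedDeriv_succ, iteratedDeriv_one,
    funext fun s => (hasDerivAt_cumulant μ g s).exp.deriv,
    ((hasDerivAt_cumulant μ g 0).exp.fun_mul (hasDerivAt_cumulant_deriv μ g 0)).deriv,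
    integral_comp_simpleFunc μ g (fun v => v), integral_comp_simpleFunc μ g (fun v => v ^ 2)]
  simp [sq]
  ring

/-- The variance of `∫ g dN` is `∫ g² dμ`. -/
lemma integral_centered_sq (hN : IsPoissonProcess P N μ) (g : SimpleFunc ℝ ℝ) :
    ∫ ω, (pointSum (N ω) g - ∫ x, g x ∂μ) ^ 2 ∂P = ∫ x, g x ^ 2 ∂μ := by
  have h2 := hN.memLp_pointSum g
  have i1 : Integrable (fun ω => pointSum (N ω) g) P := h2.integrable (by norm_num)
  have i2 : Integrable (fun ω => pointSum (N ω) g ^ 2) P := h2.integrable_sq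
  have : ∀ ω, (pointSum (N ω) g - ∫ x, g x ∂μ) ^ 2
      = pointSum (N ω) g ^ 2 - 2 * (∫ x, g x ∂μ) * pointSum (N ω) g + (∫ x, g x ∂μ) ^ 2 :=
    fun ω => by ring
  simp_rw [this]
  have i3 := i1.const_mul (2 * ∫ x, g x ∂μ)
  have i4 : Integrable (fun ω => pointSum (N ω) g ^ 2
      - 2 * (∫ x, g x ∂μ) * pointSum (N ω) g) P := i2.sub i3
  rw [integral_add i4 (integrable_const _),
    integral_sub i2 i3, integral_const_mul, hN.integral_pointSum,
    hN.integral_pointSum_sq]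
  simp
  ring

lemma integrable_exp_centered (hN : IsPoissonProcess P N μ) (g : SimpleFunc ℝ ℝ) (s : ℝ) :
    Integrable (fun ω => Real.exp (s * (pointSum (N ω) g - ∫ x, g x ∂μ))) P := by
  simp_rw [mul_sub, Real.exp_sub]
  exact (hN.integrable_exp_pointSum g s).div_const _

lemma mgf_centered (hN : IsPoissonProcess P N μ) (g : SimpleFunc ℝ ℝ) (s : ℝ) :
    mgf (fun ω => pointSum (N ω) g - ∫ x, g x ∂μ) P s
      = Real.exp (∫ x, (Real.exp (s * g x) - 1 - s * g x) ∂μ) := by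
  rw [integral_sub (integrable_comp_simpleFunc μ g (fun v => Real.exp (s * v) - 1))
    (integrable_comp_simpleFunc μ g (fun v => s * v)), Real.exp_sub, ← hN.mgf_pointSum',
    integral_const_mul, mgf, mgf, ← integral_div]
  simp_rw [mul_sub, Real.exp_sub]

end IsPoissonProcess

/-! ### Elementary inequalities -/

lemma two_mul_three_pow_le_factorial (k : ℕ) : (2 : ℝ) * 3 ^ k ≤ ((k + 2).factorial : ℝ) := by
  induction k with
  | zero => norm_num [Nat.factorial]
  | succ k ih =>
    rw [show k + 1 + 2 = (k + 2) + 1 from rfl, Nat.factorial_succ, pow_succ]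
    push_cast
    have : (0 : ℝ) ≤ k := Nat.cast_nonneg k
    nlinarith [pow_pos (show (0 : ℝ) < 3 by norm_num) k]

/-- Because (k + 2)! ≥ 2·3^k, the series beyond its linear term is dominated by x²/2 times a
geometric series of ratio y/3. This is the source of the b/3 in Bernstein's inequality. -/
lemma exp_sub_one_sub_id_le {x y : ℝ} (hx : |x| ≤ y) (hy : y < 3) :
    Real.exp x - 1 - x ≤ x ^ 2 / (2 * (1 - y / 3)) := by
  have h0 : 0 ≤ y := (abs_nonneg x).trans hx
  have h1 := NormedSpace.expSeries_div_hasSum_exp x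
  rw [← Real.exp_eq_exp_ℝ, ← hasSum_nat_add_iff' 2] at h1
  simp only [Finset.sum_range_succ, Finset.sum_range_zero] at h1
  have h2 := (hasSum_geometric_of_lt_one (r := y / 3) (by positivity) (by linarith)).mul_left
    (x ^ 2 / 2)
  have h3 := hasSum_le (fun k => ?_) h1 h2
  · have : x ^ 2 / (2 * (1 - y / 3)) = x ^ 2 / 2 * (1 - y / 3)⁻¹ := by
      rw [div_mul_eq_div_div, div_eq_mul_inv]
    rw [this]
    norm_num at h3 ⊢
    linarith
  · have hk := two_mul_three_pow_le_factorial k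
    calc x ^ (k + 2) / ((k + 2).factorial : ℝ) ≤ |x| ^ (k + 2) / ((k + 2).factorial : ℝ) := by
          rw [← abs_pow]
          exact div_le_div_of_nonneg_right (le_abs_self _) (by positivity)
      _ ≤ |x| ^ (k + 2) / (2 * 3 ^ k) := by gcongr
      _ ≤ x ^ 2 / 2 * (y / 3) ^ k := by
          rw [pow_add, sq_abs, div_pow]
          have : |x| ^ k ≤ y ^ k := by gcongr
          calc |x| ^ k * x ^ 2 / (2 * 3 ^ k) ≤ y ^ k * x ^ 2 / (2 * 3 ^ k) := by gcongr
            _ = _ := by field_simp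

/-- The choice of the exponent in the Bernstein inequality. -/
lemma exists_bernstein_exponent {v u c : ℝ} (hv : 0 < v) (hu : 0 ≤ u) (hc : 0 ≤ c) :
    ∃ s, 0 ≤ s ∧ s * c < 1 ∧
      s ^ 2 * v / (2 * (1 - s * c)) - s * (Real.sqrt (2 * v * u) + c * u) ≤ -u := by
  set r := Real.sqrt (2 * u / v) with hr
  have hr0 : 0 ≤ r := Real.sqrt_nonneg _
  have hr2 : r ^ 2 = 2 * u / v := Real.sq_sqrt (by positivity)
  have hp : 0 < 1 + c * r := by positivity
  have h1 : 1 - r / (1 + c * r) * c = 1 / (1 + c * r) := by field_simp; ring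
  have h2 : Real.sqrt (2 * v * u) = v * r := by
    rw [Real.sqrt_eq_iff_eq_sq (by positivity) (by positivity), mul_pow, hr2]
    field_simp
  -- With this s and v r² = 2u, the exponent equals −u exactly.
  refine ⟨r / (1 + c * r), by positivity, ?_, ?_⟩
  · have : 0 < 1 / (1 + c * r) := by positivity
    linarith
  · rw [h1, h2]
    have h3 : v * r ^ 2 = 2 * u := by rw [hr2]; field_simp
    have h4 : (r / (1 + c * r)) ^ 2 * v / (2 * (1 / (1 + c * r)))
        - r / (1 + c * r) * (v * r + c * u)
        = (v * r ^ 2 / 2 - v * r ^ 2 - r * c * u) / (1 + c * r) := by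
      field_simp
      ring
    rw [h4, div_le_iff₀ hp, h3]
    nlinarith

lemma sq_le_mul_exp {s x : ℝ} (hs : 0 < s) : x ^ 2 ≤ 2 / s ^ 2 * Real.exp (s * |x|) := by
  have h := Real.quadratic_le_exp_of_nonneg (x := s * |x|) (by positivity)
  have h1 : (s * |x|) ^ 2 = s ^ 2 * x ^ 2 := by rw [mul_pow, sq_abs]
  have h2 : 0 ≤ s * |x| := by positivity
  rw [div_mul_eq_mul_div, le_div_iff₀ (by positivity)]
  nlinarith

lemma exp_abs_le_add (x : ℝ) : Real.exp |x| ≤ Real.exp x + Real.exp (-x) := by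
  rcases abs_cases x with ⟨h, _⟩ | ⟨h, _⟩ <;> rw [h] <;>
    linarith [Real.exp_pos x, Real.exp_pos (-x)]

/-- Off a tail event, a square is at most `a²`; on it, it is dominated exponentially. -/
lemma sq_le_sq_add_exp {s a x : ℝ} (hs : 0 < s) :
    x ^ 2 ≤ a ^ 2 + 2 / s ^ 2 * Real.exp (-(s * a)) *
      (Real.exp (2 * s * x) + Real.exp (-(2 * s) * x)) := by
  rcases le_or_gt |x| a with h | h
  · have : x ^ 2 ≤ a ^ 2 := sq_le_sq' (by linarith [neg_abs_le x]) (by linarith [le_abs_self x])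
    have : 0 ≤ 2 / s ^ 2 * Real.exp (-(s * a)) *
      (Real.exp (2 * s * x) + Real.exp (-(2 * s) * x)) := by positivity
    linarith
  · have h1 := sq_le_mul_exp (x := x) hs
    have h2 := exp_abs_le_add (2 * s * x)
    have h3 : |2 * s * x| = 2 * s * |x| := by rw [abs_mul, abs_of_pos (by positivity)]
    have h4 : Real.exp (s * |x|) ≤ Real.exp (-(s * a)) * Real.exp |2 * s * x| := by
      rw [← Real.exp_add, Real.exp_le_exp, h3]
      nlinarith
    have h5 : -(2 * s) * x = -(2 * s * x) := by ring
    calc x ^ 2 ≤ 2 / s ^ 2 * Real.exp (s * |x|) := h1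
      _ ≤ 2 / s ^ 2 * (Real.exp (-(s * a)) * (Real.exp (2 * s * x) + Real.exp (-(2 * s * x)))) := by
          gcongr
          exact h4.trans (by gcongr)
      _ ≤ _ := by
          rw [h5, mul_assoc]
          nlinarith [sq_nonneg a]

/-- The subtracted 1 matters: for a Poisson variable K with small mean q, E(e^{2K} − 1) is of order
q, which keeps the bound summable over infinitely many nearly empty supports. For k ≥ 1, four terms
of the series give k² + 1 ≤ e^k. -/
lemma natCast_sq_mul_exp_le (k : ℕ) :
    (k : ℝ) ^ 2 * Real.exp k ≤ Real.exp (2 * k) - 1 := by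
  rcases Nat.eq_zero_or_pos k with rfl | hk
  · simp
  have hk1 : (1 : ℝ) ≤ k := by exact_mod_cast hk
  have h := Real.sum_le_exp_of_nonneg (x := (k : ℝ)) (by linarith) 4
  simp only [Finset.sum_range_succ, Finset.sum_range_zero, Nat.factorial] at h
  norm_num at h
  have h2 : Real.exp (2 * k) = Real.exp k * Real.exp k := by rw [← Real.exp_add]; ring_nf
  have h3 : (k : ℝ) ^ 2 + 1 ≤ Real.exp k := by nlinarith [sq_nonneg ((k : ℝ) - 3 / 2)]
  have h4 : 1 ≤ Real.exp (k : ℝ) := Real.one_le_exp (by linarith)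
  rw [h2]
  nlinarith [Real.exp_pos (k : ℝ)]

/-! ### Moments of the integrand -/

section Integrand

variable {μ : Measure ℝ} [IsFiniteMeasure μ] {g : SimpleFunc ℝ ℝ} {b κ : ℝ}

lemma measurableSet_simpleFunc_ne_zero (g : SimpleFunc ℝ ℝ) : MeasurableSet {x | g x ≠ 0} :=
  (g.measurableSet_fiber 0).compl

lemma integral_sq_le (hg : ∀ᵐ x ∂μ, |g x| ≤ b) :
    ∫ x, g x ^ 2 ∂μ ≤ b ^ 2 * μ.real {x | g x ≠ 0} := by
  have hS := measurableSet_simpleFunc_ne_zero g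
  rw [mul_comm, ← smul_eq_mul, ← integral_indicator_const _ hS]
  refine integral_mono_ae (integrable_comp_simpleFunc μ g (· ^ 2))
    ((integrable_const _).indicator hS) ?_
  filter_upwards [hg] with x hx
  by_cases h : g x = 0
  · simp [Set.indicator, h]
  · simp only [Set.indicator, Set.mem_ofPred_eq, h, not_false_eq_true, if_true, ne_eq]
    exact sq_le_sq' (by linarith [neg_abs_le (g x)]) (by linarith [le_abs_self (g x)])

lemma le_integral_sq (hg : ∀ x, g x ≠ 0 → κ * b ^ 2 ≤ g x ^ 2) :
    κ * b ^ 2 * μ.real {x | g x ≠ 0} ≤ ∫ x, g x ^ 2 ∂μ := by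
  have hS := measurableSet_simpleFunc_ne_zero g
  rw [mul_comm, ← smul_eq_mul, ← integral_indicator_const _ hS]
  refine integral_mono ((integrable_const _).indicator hS)
    (integrable_comp_simpleFunc μ g (· ^ 2)) fun x => ?_
  by_cases h : g x = 0
  · simp [Set.indicator, h]
  · simp only [Set.indicator, Set.mem_ofPred_eq, h, not_false_eq_true, if_true, ne_eq]
    exact hg x h

/-- Cauchy–Schwarz against the indicator of the support, read off from the discriminant of t ↦ ∫ (g
− t)² dμ over that support. -/
lemma sq_integral_le :
    (∫ x, g x ∂μ) ^ 2 ≤ μ.real {x | g x ≠ 0} * ∫ x, g x ^ 2 ∂μ := by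
  have hS := measurableSet_simpleFunc_ne_zero g
  set q := μ.real {x | g x ≠ 0} with hq
  have h (t : ℝ) : 0 ≤ q * (t * t) + (-2 * ∫ x, g x ∂μ) * t + ∫ x, g x ^ 2 ∂μ := by
    have h1 : 0 ≤ ∫ x, (g x ^ 2 - 2 * t * g x + {x | g x ≠ 0}.indicator (fun _ => t ^ 2) x) ∂μ := by
      refine integral_nonneg fun x => ?_
      by_cases h : g x = 0
      · simp [Set.indicator, h]
      · simp only [Set.indicator, Set.mem_ofPred_eq, h, not_false_eq_true, if_true, ne_eq,
          Pi.zero_apply]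
        nlinarith [sq_nonneg (g x - t)]
    rw [integral_add (integrable_comp_simpleFunc μ g (fun v => v ^ 2 - 2 * t * v))
      ((integrable_const _).indicator hS),
      integral_sub (integrable_comp_simpleFunc μ g (· ^ 2))
        (integrable_comp_simpleFunc μ g (2 * t * ·)), integral_const_mul,
      integral_indicator_const _ hS, smul_eq_mul] at h1
    linarith
  have := discrim_le_zero h
  rw [discrim] at this
  nlinarith

/-- The logarithmic moment generating function in the Bernstein inequality. -/
lemma integral_exp_sub_le (hg : ∀ᵐ x ∂μ, |g x| ≤ b) {s : ℝ} (hs : |s| * (b / 3) < 1) :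
    ∫ x, (Real.exp (s * g x) - 1 - s * g x) ∂μ
      ≤ s ^ 2 * (∫ x, g x ^ 2 ∂μ) / (2 * (1 - |s| * (b / 3))) := by
  rw [← integral_const_mul, ← integral_div]
  refine integral_mono_ae (integrable_comp_simpleFunc μ g (fun v => Real.exp (s * v) - 1 - s * v))
    (integrable_comp_simpleFunc μ g
      (fun v => s ^ 2 * v ^ 2 / (2 * (1 - |s| * (b / 3))))) ?_
  filter_upwards [hg] with x hx
  have h := exp_sub_one_sub_id_le (x := s * g x) (y := |s| * b)
    (by rw [abs_mul]; gcongr) (by linarith)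
  rw [mul_pow, mul_div_assoc |s|] at h
  exact h

lemma integral_exp_sub_le_sq (hg : ∀ᵐ x ∂μ, |g x| ≤ b) {s : ℝ} (hs : |s| * b ≤ 1) :
    ∫ x, (Real.exp (s * g x) - 1 - s * g x) ∂μ ≤ s ^ 2 * ∫ x, g x ^ 2 ∂μ := by
  rw [← integral_const_mul]
  refine integral_mono_ae (integrable_comp_simpleFunc μ g (fun v => Real.exp (s * v) - 1 - s * v))
    (integrable_comp_simpleFunc μ g (fun v => s ^ 2 * v ^ 2)) ?_
  filter_upwards [hg] with x hx
  have h1 : |s * g x| ≤ 1 := by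
    rw [abs_mul]
    exact (by gcongr : |s| * |g x| ≤ |s| * b).trans hs
  have h := (abs_le.1 (Real.abs_exp_sub_one_sub_id_le h1)).2
  rw [mul_pow] at h
  exact h

end Integrand

lemma pointSum_neg (N : Set ℝ) (g : ℝ → ℝ) : pointSum N (fun x => -g x) = -pointSum N g := by
  simp [pointSum, tsum_neg]

/-! ### Bernstein inequalities and truncated moments of Poisson sums -/

namespace IsPoissonProcess

variable {Ω : Type*} [MeasurableSpace Ω] {P : Measure Ω} [IsProbabilityMeasure P]
  {N : Ω → Set ℝ} {μ : Measure ℝ} [IsFiniteMeasure μ] {g : SimpleFunc ℝ ℝ} {b v : ℝ}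

/-- Chernoff's bound at the exponent of `exists_bernstein_exponent`. Allowing v to exceed the
variance lets the same inequality serve g², whose second moment is only estimated. -/
lemma bernstein (hN : IsPoissonProcess P N μ) (hb : 0 ≤ b) (hg : ∀ᵐ x ∂μ, |g x| ≤ b)
    (hv : 0 < v) (hgv : ∫ x, g x ^ 2 ∂μ ≤ v) {u : ℝ} (hu : 0 ≤ u) :
    P.real {ω | Real.sqrt (2 * v * u) + b / 3 * u ≤ pointSum (N ω) g - ∫ x, g x ∂μ}
      ≤ Real.exp (-u) := by
  obtain ⟨s, hs, hsc, h⟩ := exists_bernstein_exponent hv hu (c := b / 3) (by positivity)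
  refine (measure_ge_le_exp_mul_mgf _ hs (hN.integrable_exp_centered g s)).trans ?_
  rw [hN.mgf_centered, ← Real.exp_add, Real.exp_le_exp]
  have h1 := integral_exp_sub_le (s := s) hg (by rwa [abs_of_nonneg hs])
  rw [abs_of_nonneg hs] at h1
  have h2 : s ^ 2 * (∫ x, g x ^ 2 ∂μ) / (2 * (1 - s * (b / 3)))
      ≤ s ^ 2 * v / (2 * (1 - s * (b / 3))) := by
    have : 0 < 1 - s * (b / 3) := by linarith
    gcongr
  linarith

lemma bernstein_lower (hN : IsPoissonProcess P N μ) (hb : 0 ≤ b) (hg : ∀ᵐ x ∂μ, |g x| ≤ b)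
    (hv : 0 < v) (hgv : ∫ x, g x ^ 2 ∂μ ≤ v) {u : ℝ} (hu : 0 ≤ u) :
    P.real {ω | Real.sqrt (2 * v * u) + b / 3 * u ≤ (∫ x, g x ∂μ) - pointSum (N ω) g}
      ≤ Real.exp (-u) := by
  have h := hN.bernstein (g := g.map (fun x => -x)) hb (by simpa using hg) hv (by simpa using hgv)
    hu
  have h1 : (g.map (fun x => -x) : ℝ → ℝ) = fun x => -g x := by ext; simp
  simp_rw [h1, pointSum_neg, integral_neg] at h
  simpa only [neg_sub_neg] using h

lemma bernstein_abs (hN : IsPoissonProcess P N μ) (hb : 0 ≤ b) (hg : ∀ᵐ x ∂μ, |g x| ≤ b)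
    (hv : 0 < v) (hgv : ∫ x, g x ^ 2 ∂μ ≤ v) {u : ℝ} (hu : 0 ≤ u) :
    P.real {ω | Real.sqrt (2 * v * u) + b / 3 * u ≤ |pointSum (N ω) g - ∫ x, g x ∂μ|}
      ≤ 2 * Real.exp (-u) := by
  have h1 := hN.bernstein hb hg hv hgv hu
  have h2 := hN.bernstein_lower hb hg hv hgv hu
  refine le_trans (measureReal_mono ?_) ((measureReal_union_le
    {ω | Real.sqrt (2 * v * u) + b / 3 * u ≤ pointSum (N ω) g - ∫ x, g x ∂μ}
    {ω | Real.sqrt (2 * v * u) + b / 3 * u ≤ (∫ x, g x ∂μ) - pointSum (N ω) g}).trans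
    (by linarith))
  intro ω hω
  rcases le_abs.1 (Set.mem_ofPred_eq ▸ hω) with h | h
  · exact Or.inl h
  · exact Or.inr (by simp only [Set.mem_ofPred_eq]; linarith)

/-- The empirical second moment does not fall far below its mean. -/
lemma bernstein_sq (hN : IsPoissonProcess P N μ) (hb : 0 < b) (hg : ∀ᵐ x ∂μ, |g x| ≤ b)
    (hv : 0 < ∫ x, g x ^ 2 ∂μ) {u : ℝ} (hu : 0 ≤ u) :
    P.real {ω | Real.sqrt (2 * (b ^ 2 * ∫ x, g x ^ 2 ∂μ) * u) + b ^ 2 / 3 * u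
        ≤ (∫ x, g x ^ 2 ∂μ) - pointSum (N ω) (fun x => g x ^ 2)} ≤ Real.exp (-u) := by
  -- The fourth power of g integrates to at most b² ∫ g² dμ.
  refine hN.bernstein_lower (g := g.map (· ^ 2)) (b := b ^ 2) (v := b ^ 2 * ∫ x, g x ^ 2 ∂μ)
    (by positivity) ?_ (by positivity) ?_ hu
  · filter_upwards [hg] with x hx
    simp only [SimpleFunc.coe_map, Function.comp_apply, abs_pow]
    gcongr
  · rw [← integral_const_mul]
    refine integral_mono_ae (integrable_comp_simpleFunc μ g (fun v => (v ^ 2) ^ 2))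
      (integrable_comp_simpleFunc μ g (fun v => b ^ 2 * v ^ 2)) ?_
    filter_upwards [hg] with x hx
    have : g x ^ 2 ≤ b ^ 2 := sq_le_sq' (by linarith [neg_abs_le (g x)]) (by linarith [le_abs_self (g x)])
    have h2 : (g x ^ 2) ^ 2 ≤ b ^ 2 * g x ^ 2 := by nlinarith [sq_nonneg (g x)]
    exact h2

lemma mgf_centered_le (hN : IsPoissonProcess P N μ) (hg : ∀ᵐ x ∂μ, |g x| ≤ b) {s : ℝ}
    (hs : |s| * b ≤ 1) :
    ∫ ω, Real.exp (s * (pointSum (N ω) g - ∫ x, g x ∂μ)) ∂P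
      ≤ Real.exp (s ^ 2 * ∫ x, g x ^ 2 ∂μ) := by
  have h := hN.mgf_centered g s
  rw [mgf] at h
  rw [h, Real.exp_le_exp]
  exact integral_exp_sub_le_sq hg hs

/-- Truncating at a keeps the full factor P(B), where Cauchy–Schwarz would leave only its square
root; the part above a is controlled by exponential moments at ±2s, over the whole space. -/
lemma setIntegral_centered_sq_le (hN : IsPoissonProcess P N μ) (hg : ∀ᵐ x ∂μ, |g x| ≤ b)
    {s a : ℝ} (hs : 0 < s) (hsb : 2 * s * b ≤ 1) (B : Set Ω) :
    ∫ ω in B, (pointSum (N ω) g - ∫ x, g x ∂μ) ^ 2 ∂P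
      ≤ a ^ 2 * P.real B + 4 / s ^ 2 * Real.exp (4 * s ^ 2 * (∫ x, g x ^ 2 ∂μ) - s * a) := by
  have i1 := hN.integrable_exp_centered g (2 * s)
  have i2 := hN.integrable_exp_centered g (-(2 * s))
  have j : Integrable (fun ω => 2 / s ^ 2 * Real.exp (-(s * a)) *
      (Real.exp (2 * s * (pointSum (N ω) g - ∫ x, g x ∂μ))
        + Real.exp (-(2 * s) * (pointSum (N ω) g - ∫ x, g x ∂μ)))) P := (i1.add i2).const_mul _
  have habs : |2 * s| = 2 * s := abs_of_pos (by positivity)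
  have e1 := hN.mgf_centered_le (s := 2 * s) hg (by rwa [habs])
  have e2 := hN.mgf_centered_le (s := -(2 * s)) hg (by rwa [abs_neg, habs])
  calc ∫ ω in B, (pointSum (N ω) g - ∫ x, g x ∂μ) ^ 2 ∂P
      ≤ ∫ ω in B, (a ^ 2 + 2 / s ^ 2 * Real.exp (-(s * a)) *
          (Real.exp (2 * s * (pointSum (N ω) g - ∫ x, g x ∂μ))
            + Real.exp (-(2 * s) * (pointSum (N ω) g - ∫ x, g x ∂μ)))) ∂P :=
        integral_mono_of_nonneg (.of_forall fun ω => sq_nonneg _)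
          (((integrable_const _).add j).restrict) (.of_forall fun ω => sq_le_sq_add_exp hs)
    _ = a ^ 2 * P.real B + ∫ ω in B, 2 / s ^ 2 * Real.exp (-(s * a)) *
          (Real.exp (2 * s * (pointSum (N ω) g - ∫ x, g x ∂μ))
            + Real.exp (-(2 * s) * (pointSum (N ω) g - ∫ x, g x ∂μ))) ∂P := by
        rw [integral_add (integrable_const _) j.restrict]
        simp [mul_comm]
    _ ≤ a ^ 2 * P.real B + ∫ ω, 2 / s ^ 2 * Real.exp (-(s * a)) *
          (Real.exp (2 * s * (pointSum (N ω) g - ∫ x, g x ∂μ))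
            + Real.exp (-(2 * s) * (pointSum (N ω) g - ∫ x, g x ∂μ))) ∂P := by
        refine add_le_add le_rfl ?_
        exact setIntegral_le_integral j (.of_forall fun ω => by positivity)
    _ ≤ _ := by
        rw [integral_const_mul, integral_add i1 i2, sub_eq_add_neg _ (s * a), Real.exp_add]
        have e3 : (2 * s) ^ 2 * ∫ x, g x ^ 2 ∂μ = 4 * s ^ 2 * ∫ x, g x ^ 2 ∂μ := by ring
        have e4 : (-(2 * s)) ^ 2 * ∫ x, g x ^ 2 ∂μ = 4 * s ^ 2 * ∫ x, g x ^ 2 ∂μ := by ring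
        rw [e3] at e1
        rw [e4] at e2
        calc _ ≤ a ^ 2 * P.real B + 2 / s ^ 2 * Real.exp (-(s * a)) *
              (Real.exp (4 * s ^ 2 * ∫ x, g x ^ 2 ∂μ)
                + Real.exp (4 * s ^ 2 * ∫ x, g x ^ 2 ∂μ)) := by gcongr
          _ = _ := by ring

/-- The truncated second moment on a set of small probability, when the variance is large. -/
lemma setIntegral_centered_sq_le_of_large (hN : IsPoissonProcess P N μ)
    (hg : ∀ᵐ x ∂μ, |g x| ≤ b) (hv : 0 < ∫ x, g x ^ 2 ∂μ) {τ γ L : ℝ} (hτ : 0 < τ)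
    (hL : 0 < L) (hbig : 4 * τ * b ^ 2 * L ≤ ∫ x, g x ^ 2 ∂μ) (B : Set Ω) :
    ∫ ω in B, (pointSum (N ω) g - ∫ x, g x ∂μ) ^ 2 ∂P
      ≤ (4 * τ + γ) ^ 2 / τ * (∫ x, g x ^ 2 ∂μ) * L * P.real B
        + 4 * (∫ x, g x ^ 2 ∂μ) / (τ * L) * Real.exp (-(γ * L)) := by
  set v := ∫ x, g x ^ 2 ∂μ
  -- This makes s²v = τL, while the lower bound on v gives exactly (2sb)² ≤ 1.
  set s := Real.sqrt (τ * L / v)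
  have hs : 0 < s := Real.sqrt_pos.2 (by positivity)
  have hs2 : s ^ 2 = τ * L / v := Real.sq_sqrt (by positivity)
  have hsb : 2 * s * b ≤ 1 := by
    refine abs_le_one_iff_mul_self_le_one.2 ?_ |> (le_abs_self _).trans
    have : 2 * s * b * (2 * s * b) = 4 * τ * b ^ 2 * L / v := by
      calc 2 * s * b * (2 * s * b) = 4 * s ^ 2 * b ^ 2 := by ring
        _ = _ := by rw [hs2]; ring
    rw [this, div_le_one hv]
    exact hbig
  -- The truncation level is solved from 4s²v − sa = −γL.
  have h := hN.setIntegral_centered_sq_le hg hs hsb (a := (4 * τ + γ) * L / s) B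
  refine h.trans (le_of_eq ?_)
  have e1 : ((4 * τ + γ) * L / s) ^ 2 = (4 * τ + γ) ^ 2 / τ * v * L := by
    rw [div_pow, hs2]
    field_simp
  have e2 : 4 * s ^ 2 * v - s * ((4 * τ + γ) * L / s) = -(γ * L) := by
    rw [hs2]
    field_simp
    ring
  rw [e1, e2, hs2]
  congr 2
  field_simp

lemma pointSum_sq_nonneg (N : Set ℝ) (g : ℝ → ℝ) : 0 ≤ pointSum N (fun x => g x ^ 2) :=
  tsum_nonneg fun _ => sq_nonneg _

/-- The exceptional set of the bound is μ-null, so its count is Poisson with parameter 0 and almost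
surely no point of the process falls in it. -/
lemma ae_abs_pointSum_le (hN : IsPoissonProcess P N μ) (hg : ∀ᵐ x ∂μ, |g x| ≤ b) :
    ∀ᵐ ω ∂P, |pointSum (N ω) g| ≤ b * realCount N {x | g x ≠ 0} ω := by
  classical
  have hE : MeasurableSet {x | ¬ |g x| ≤ b} :=
    (measurableSet_le (continuous_abs.measurable.comp g.measurable) measurable_const).compl
  have h0 : μ {x | ¬ |g x| ≤ b} = 0 := hg
  have h1 := hN.law_count _ hE (measure_ne_top μ _)
  have h2 : ∀ᵐ k ∂(P.map (pointCount N {x | ¬ |g x| ≤ b})), k = 0 := by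
    rw [h1, ae_map_iff (measurable_of_countable _).aemeasurable (by measurability), h0, ae_iff_of_countable]
    intro k hk
    by_contra h
    apply hk
    rw [poissonMeasure_singleton]
    have : k ≠ 0 := by simpa using h
    simp [this]
  have h3 := ae_of_ae_map (hN.measurable_count _ hE).aemeasurable h2
  filter_upwards [h3, hN.ae_finite] with ω hω hfin
  have hle : ∀ T ∈ N ω, |g T| ≤ b := by
    intro T hT
    by_contra h
    rw [pointCount, Set.encard_eq_zero] at hω
    exact (Set.mem_empty_iff_false T).1 (hω ▸ ⟨hT, h⟩)
  have : Fintype (N ω) := hfin.fintype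
  rw [pointSum, tsum_fintype]
  refine (Finset.abs_sum_le_sum_abs _ _).trans ?_
  have h4 : ∀ T : N ω, |g T| ≤ if g T ≠ 0 then b else 0 := by
    intro T
    split_ifs with h
    · exact hle T T.2
    · simp_all
  refine (Finset.sum_le_sum fun T _ => h4 T).trans ?_
  rw [← Finset.sum_filter, Finset.sum_const, nsmul_eq_mul, mul_comm, realCount, pointCount]
  refine le_of_eq ?_
  congr 2
  rw [Set.encard_eq_coe_toFinset_card (N ω ∩ {x | g x ≠ 0}), ENat.toNat_natCast]
  rw [← Finset.card_map (Function.Embedding.subtype _)]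
  congr 1
  ext x
  simp [and_comm]

end IsPoissonProcess

/-! ### The data-driven threshold -/

/-- The upper estimate of a variance from its unbiased estimate `w`, with `u = γ ln n` and the
bound `b` of the integrand (unnormalised). -/
def upperVar (u b w : ℝ) : ℝ := w + Real.sqrt (2 * u * w * b ^ 2) + 3 * u * b ^ 2

/-- The unnormalised threshold. -/
def rawThreshold (u b w : ℝ) : ℝ := Real.sqrt (2 * u * upperVar u b w) + u / 3 * b

section Threshold

variable {u b w v : ℝ}

lemma upperVar_le (hu : 0 ≤ u) (hw : 0 ≤ w) : upperVar u b w ≤ 2 * w + 4 * u * b ^ 2 := by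
  have : Real.sqrt (2 * u * w * b ^ 2) ≤ w + u * b ^ 2 := by
    apply Real.sqrt_le_iff.2 ⟨by positivity, ?_⟩
    nlinarith [sq_nonneg w, sq_nonneg (u * b ^ 2)]
  rw [upperVar]
  linarith

lemma le_upperVar (hw : 0 ≤ w) : 3 * u * b ^ 2 ≤ upperVar u b w := by
  rw [upperVar]
  have := Real.sqrt_nonneg (2 * u * w * b ^ 2)
  linarith

/-- Linearity in w is the purpose: w is unbiased for v, so the expected squared threshold is
controlled by v. -/
lemma rawThreshold_sq_le (hu : 0 ≤ u) (hw : 0 ≤ w) :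
    rawThreshold u b w ^ 2 ≤ 8 * u * w + 17 * u ^ 2 * b ^ 2 := by
  have h1 := upperVar_le (b := b) hu hw
  have h2 := le_upperVar (u := u) (b := b) hw
  have h3 : Real.sqrt (2 * u * upperVar u b w) ^ 2 = 2 * u * upperVar u b w :=
    Real.sq_sqrt (mul_nonneg (by positivity) (le_trans (by positivity) h2))
  have h4 : 2 * u * upperVar u b w ≤ 2 * u * (2 * w + 4 * u * b ^ 2) := by gcongr
  rw [rawThreshold]
  nlinarith [sq_nonneg (Real.sqrt (2 * u * upperVar u b w) - u / 3 * b), sq_nonneg (u * b)]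

lemma le_rawThreshold (hu : 0 ≤ u) (hb : 0 ≤ b) (hw : 0 ≤ w) : 2 * u * b ≤ rawThreshold u b w := by
  have h2 := le_upperVar (u := u) (b := b) hw
  have : 2 * u * b ≤ Real.sqrt (2 * u * upperVar u b w) := by
    apply Real.le_sqrt_of_sq_le
    have : 2 * u * (3 * u * b ^ 2) ≤ 2 * u * upperVar u b w := by gcongr
    nlinarith [sq_nonneg (u * b)]
  rw [rawThreshold]
  have : 0 ≤ u / 3 * b := by positivity
  linarith

/-- Inverts Bernstein's inequality for the empirical variance: its fluctuation term contains the
unknown v, which must be replaced by the observed w. -/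
lemma le_upperVar_of_sub_lt (hu : 0 ≤ u) (hw : 0 ≤ w) (hv : 0 ≤ v)
    (h : v - w < Real.sqrt (2 * (b ^ 2 * v) * u) + b ^ 2 / 3 * u) : v ≤ upperVar u b w := by
  by_contra! hlt
  rw [upperVar] at hlt
  set y := Real.sqrt v with hy
  set x := Real.sqrt w with hx
  set t := Real.sqrt (u * b ^ 2) with ht
  have hy2 : y ^ 2 = v := Real.sq_sqrt hv
  have hx2 : x ^ 2 = w := Real.sq_sqrt hw
  have ht2 : t ^ 2 = u * b ^ 2 := Real.sq_sqrt (by positivity)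
  have hs2 : Real.sqrt 2 ^ 2 = 2 := Real.sq_sqrt (by norm_num)
  set r := Real.sqrt 2 with hr
  have e1 : Real.sqrt (2 * (b ^ 2 * v) * u) = r * t * y := by
    rw [hr, ht, hy, ← Real.sqrt_mul (by norm_num), ← Real.sqrt_mul (by positivity)]
    ring_nf
  have e2 : Real.sqrt (2 * u * w * b ^ 2) = r * t * x := by
    rw [hr, ht, hx, ← Real.sqrt_mul (by norm_num), ← Real.sqrt_mul (by positivity)]
    ring_nf
  rw [e1] at h
  rw [e2] at hlt
  have hy0 : 0 ≤ y := Real.sqrt_nonneg _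
  have hx0 : 0 ≤ x := Real.sqrt_nonneg _
  have ht0 : 0 ≤ t := Real.sqrt_nonneg _
  have hr0 : 0 ≤ r := Real.sqrt_nonneg _
  have hr1 : r ≤ 3 / 2 := by nlinarith
  have k1 : x ^ 2 + r * t * x + 3 * t ^ 2 < y ^ 2 := by rw [hx2, hy2, ht2]; linarith
  have k2 : y ^ 2 - x ^ 2 < r * t * y + t ^ 2 / 3 := by rw [hx2, hy2, ht2]; linarith
  -- With √2 ≤ 3/2, the factor a = 17/10 must satisfy 3a/2 + 1/3 ≤ 3 (first case) and a(a − 3/2) ≥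
  -- 1/3 (second case); it does, narrowly in the second.
  rcases le_or_gt y (x + 17 / 10 * t) with h3 | h3
  · have : r * t * y ≤ r * t * (x + 17 / 10 * t) := by gcongr
    nlinarith [mul_nonneg hr0 (mul_nonneg ht0 ht0), mul_nonneg ht0 ht0]
  · nlinarith [mul_nonneg ht0 hx0, mul_nonneg ht0 ht0, mul_nonneg ht0 hy0,
      mul_le_mul_of_nonneg_right hr1 (mul_nonneg ht0 hy0)]

/-- The threshold dominates √(2γ)·√(vL); subtracting |m| ≤ δ√(vL) still leaves √(2γ')·√(vL), the
fluctuation allowed by Bernstein at level γ'L. -/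
lemma bernstein_le_of_rawThreshold_le {γ γ' δ L m z : ℝ} (hL : 0 ≤ L) (hγ' : 0 ≤ γ')
    (hγ : γ' ≤ γ) (hδ : Real.sqrt (2 * γ') + δ ≤ Real.sqrt (2 * γ)) (hb : 0 ≤ b)
    (hvw : v ≤ upperVar (γ * L) b w) (hm : |m| ≤ δ * Real.sqrt (v * L))
    (hz : rawThreshold (γ * L) b w ≤ |z|) :
    Real.sqrt (2 * v * (γ' * L)) + b / 3 * (γ' * L) ≤ |z - m| := by
  have h1 : Real.sqrt (2 * v * (γ' * L)) = Real.sqrt (2 * γ') * Real.sqrt (v * L) := by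
    rw [← Real.sqrt_mul (by positivity)]
    ring_nf
  have h2 : Real.sqrt (2 * γ) * Real.sqrt (v * L)
      ≤ Real.sqrt (2 * (γ * L) * upperVar (γ * L) b w) := by
    rw [← Real.sqrt_mul (by linarith)]
    apply Real.sqrt_le_sqrt
    have : 0 ≤ 2 * (γ * L) := by have := hγ'.trans hγ; positivity
    nlinarith [mul_le_mul_of_nonneg_left hvw this]
  have h3 : (Real.sqrt (2 * γ') + δ) * Real.sqrt (v * L)
      ≤ Real.sqrt (2 * γ) * Real.sqrt (v * L) := by gcongr
  have h4 : b / 3 * (γ' * L) ≤ γ * L / 3 * b := by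
    have : γ' * L * b ≤ γ * L * b := by gcongr
    linarith
  have h5 := abs_sub_abs_le_abs_sub z m
  rw [rawThreshold] at hz
  rw [h1]
  linarith

end Threshold

open Classical in
/-- The error of thresholding `z` at the level `h`, as an estimate of `m`. -/
def thresholdError (h z m : ℝ) : ℝ := (if h ≤ |z| then z else 0) - m

section ThresholdError

variable {h z m : ℝ}

lemma thresholdError_sq_le_add : thresholdError h z m ^ 2 ≤ (z - m) ^ 2 + m ^ 2 := by
  rw [thresholdError]
  split_ifs <;> nlinarith [sq_nonneg m, sq_nonneg (z - m)]

lemma thresholdError_sq_le_of_lt (hz : |z| < h) :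
    thresholdError h z m ^ 2 ≤ m ^ 2 := by
  rw [thresholdError, if_neg (not_le.2 hz)]
  simp

lemma sq_le_of_abs_lt (hz : |z| < h) : m ^ 2 ≤ 2 * (z - m) ^ 2 + 2 * h ^ 2 := by
  have : z ^ 2 ≤ h ^ 2 := sq_le_sq' (by linarith [neg_abs_le z]) (by linarith [le_abs_self z])
  nlinarith [sq_nonneg (m - 2 * z)]

lemma thresholdError_sq_of_le (hz : h ≤ |z|) : thresholdError h z m ^ 2 = (z - m) ^ 2 := by
  rw [thresholdError, if_pos hz]

end ThresholdError

lemma lintegral_ofReal_le {Ω : Type*} [MeasurableSpace Ω] {P : Measure Ω} {D F : Ω → ℝ} {C : ℝ}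
    (hD : ∀ ω, 0 ≤ D ω) (hF : Integrable F P) (hDF : ∀ᵐ ω ∂P, D ω ≤ F ω)
    (hC : ∫ ω, F ω ∂P ≤ C) : ∫⁻ ω, ENNReal.ofReal (D ω) ∂P ≤ ENNReal.ofReal C := by
  calc ∫⁻ ω, ENNReal.ofReal (D ω) ∂P ≤ ∫⁻ ω, ENNReal.ofReal (F ω) ∂P :=
        lintegral_mono_ae (hDF.mono fun ω h => ENNReal.ofReal_le_ofReal h)
    _ = ENNReal.ofReal (∫ ω, F ω ∂P) :=
        (ofReal_integral_eq_lintegral_ofReal hF (hDF.mono fun ω h => (hD ω).trans h)).symm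
    _ ≤ _ := ENNReal.ofReal_le_ofReal hC

lemma coe_map_sq (g : SimpleFunc ℝ ℝ) : ⇑(g.map (· ^ 2)) = fun x => g x ^ 2 := by
  ext x
  simp

/-- The constant in the bound of the squared bias of thresholding. -/
def biasConst (γ κ : ℝ) : ℝ := 16 * γ + 272 * γ ^ 2 / κ

lemma one_le_biasConst {γ κ : ℝ} (hκ : 0 < κ) (hγ : 1 ≤ γ) : 1 ≤ biasConst γ κ := by
  rw [biasConst]
  have : 0 ≤ 272 * γ ^ 2 / κ := by positivity
  linarith

/-- The quadratic loss of the thresholded sum of `g` over the point set. -/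
def coeffLoss (u b : ℝ) (g : ℝ → ℝ) (m : ℝ) (N : Set ℝ) : ℝ :=
  thresholdError (rawThreshold u b (pointSum N fun x => g x ^ 2)) (pointSum N g) m ^ 2

lemma measurable_thresholdError_rawThreshold (u b m : ℝ) :
    Measurable fun p : ℝ × ℝ => thresholdError (rawThreshold u b p.2) p.1 m := by
  have h1 : Measurable fun p : ℝ × ℝ => rawThreshold u b p.2 := by
    unfold rawThreshold upperVar
    fun_prop
  have h2 : Measurable fun p : ℝ × ℝ => |p.1| := continuous_abs.measurable.comp measurable_fst
  exact (Measurable.ite (measurableSet_le h1 h2) measurable_fst measurable_const).sub_const m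

/-! ### Risk bounds for one thresholded coefficient -/

namespace IsPoissonProcess

variable {Ω : Type*} [MeasurableSpace Ω] {P : Measure Ω} [IsProbabilityMeasure P]
  {N : Ω → Set ℝ} {μ : Measure ℝ} [IsFiniteMeasure μ] {g : SimpleFunc ℝ ℝ} {b κ γ L : ℝ}

lemma integrable_centered_sq (hN : IsPoissonProcess P N μ) (g : SimpleFunc ℝ ℝ) :
    Integrable (fun ω => (pointSum (N ω) g - ∫ x, g x ∂μ) ^ 2) P :=
  ((hN.memLp_pointSum g).sub (memLp_const (∫ x, g x ∂μ))).integrable_sq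

lemma integrable_pointSum_sq (hN : IsPoissonProcess P N μ) (g : SimpleFunc ℝ ℝ) :
    Integrable (fun ω => pointSum (N ω) (fun x => g x ^ 2)) P := by
  rw [← coe_map_sq]
  exact (hN.memLp_pointSum _).integrable (by norm_num)

lemma integral_pointSum_of_sq (hN : IsPoissonProcess P N μ) (g : SimpleFunc ℝ ℝ) :
    ∫ ω, pointSum (N ω) (fun x => g x ^ 2) ∂P = ∫ x, g x ^ 2 ∂μ := by
  rw [← coe_map_sq, hN.integral_pointSum]

lemma aemeasurable_coeffLoss (hN : IsPoissonProcess P N μ) (g : SimpleFunc ℝ ℝ) (u b m : ℝ) :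
    AEMeasurable (fun ω => coeffLoss u b g m (N ω)) P := by
  have h1 := hN.aemeasurable_pointSum g
  have h2 := hN.aemeasurable_pointSum (g.map (· ^ 2))
  rw [coe_map_sq] at h2
  have h3 := (measurable_thresholdError_rawThreshold u b m).comp_aemeasurable (h1.prodMk h2)
  unfold coeffLoss
  exact h3.pow_const 2

/-- The bound by variance plus squared bias. -/
lemma lintegral_coeffLoss_le_add (hN : IsPoissonProcess P N μ) (u b : ℝ) :
    ∫⁻ ω, ENNReal.ofReal (coeffLoss u b g (∫ x, g x ∂μ) (N ω)) ∂P
      ≤ ENNReal.ofReal (∫ x, g x ^ 2 ∂μ + (∫ x, g x ∂μ) ^ 2) := by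
  refine lintegral_ofReal_le (fun ω => sq_nonneg _)
    ((hN.integrable_centered_sq g).add (integrable_const ((∫ x, g x ∂μ) ^ 2)))
    (.of_forall fun ω => thresholdError_sq_le_add) ?_
  rw [integral_add' (hN.integrable_centered_sq g) (integrable_const _), hN.integral_centered_sq]
  simp

/-- No deviation estimate is needed: a kept coefficient costs (Z − m)², with Z the point sum, and a
killed one costs m² ≤ 2(Z − m)² + 2η², where the squared threshold η² has mean of order vL because v
dominates b²L. -/
lemma lintegral_coeffLoss_le_of_large (hN : IsPoissonProcess P N μ)
    (hκ : 0 < κ) (hγ : 0 ≤ γ) (hL : 0 ≤ L) (hbig : κ * b ^ 2 * L ≤ 8 * ∫ x, g x ^ 2 ∂μ) :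
    ∫⁻ ω, ENNReal.ofReal (coeffLoss (γ * L) b g (∫ x, g x ∂μ) (N ω)) ∂P
      ≤ ENNReal.ofReal (3 * (∫ x, g x ^ 2 ∂μ) + biasConst γ κ * ((∫ x, g x ^ 2 ∂μ) * L)) := by
  have i1 := (hN.integrable_centered_sq g).const_mul 3
  have i2 := (hN.integrable_pointSum_sq g).const_mul (16 * (γ * L))
  refine lintegral_ofReal_le (fun ω => sq_nonneg _)
    ((i1.add i2).add (integrable_const (34 * (γ * L) ^ 2 * b ^ 2)))
    (.of_forall fun ω => ?_) ?_
  · have hw := pointSum_sq_nonneg (N ω) g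
    have hu : 0 ≤ γ * L := by positivity
    have h1 := rawThreshold_sq_le (b := b) hu hw
    simp only [Pi.add_apply, coeffLoss]
    have hp : 0 ≤ 16 * (γ * L) * pointSum (N ω) (fun x => g x ^ 2) := by positivity
    have hp' : 0 ≤ 34 * (γ * L) ^ 2 * b ^ 2 := by positivity
    have hp'' := sq_nonneg (pointSum (N ω) g - ∫ x, g x ∂μ)
    rcases le_or_gt (rawThreshold (γ * L) b (pointSum (N ω) fun x => g x ^ 2))
      |pointSum (N ω) g| with h | h
    · rw [thresholdError_sq_of_le h]
      linarith
    · have h2 := thresholdError_sq_le_of_lt (m := ∫ x, g x ∂μ) h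
      have h3 := sq_le_of_abs_lt (m := ∫ x, g x ∂μ) h
      linarith
  · rw [integral_add' (i1.add i2) (integrable_const _), integral_add' i1 i2, integral_const_mul,
      integral_const_mul, hN.integral_centered_sq, hN.integral_pointSum_of_sq]
    simp only [integral_const, probReal_univ, smul_eq_mul, one_mul, biasConst]
    -- One factor b²L is traded for 8v/κ, and 34·8 = 272.
    have : 34 * (γ * L) ^ 2 * b ^ 2 ≤ 272 * γ ^ 2 / κ * ((∫ x, g x ^ 2 ∂μ) * L) := by
      have h4 : b ^ 2 * L ≤ 8 * (∫ x, g x ^ 2 ∂μ) / κ := by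
        rw [le_div_iff₀ hκ]
        linarith
      calc 34 * (γ * L) ^ 2 * b ^ 2 = 34 * γ ^ 2 * L * (b ^ 2 * L) := by ring
        _ ≤ 34 * γ ^ 2 * L * (8 * (∫ x, g x ^ 2 ∂μ) / κ) := by gcongr
        _ = _ := by ring
    linarith

/-- The risk bound without remainder: valid for every sample size, but with the full variance. -/
lemma lintegral_coeffLoss_le (hN : IsPoissonProcess P N μ) (hκ : 0 < κ)
    (hgκ : ∀ x, g x ≠ 0 → κ * b ^ 2 ≤ g x ^ 2) (hγ : 1 ≤ γ) (hL : 0 ≤ L) :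
    ∫⁻ ω, ENNReal.ofReal (coeffLoss (γ * L) b g (∫ x, g x ∂μ) (N ω)) ∂P
      ≤ ENNReal.ofReal (3 * (∫ x, g x ^ 2 ∂μ)
        + biasConst γ κ * min ((∫ x, g x ∂μ) ^ 2) ((∫ x, g x ^ 2 ∂μ) * L)) := by
  have hv : 0 ≤ ∫ x, g x ^ 2 ∂μ := integral_nonneg fun x => sq_nonneg _
  have hK := one_le_biasConst hκ hγ
  have h1 := hN.lintegral_coeffLoss_le_add (g := g) (γ * L) b
  have hadd : (∫ x, g x ^ 2 ∂μ) + (∫ x, g x ∂μ) ^ 2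
      ≤ 3 * (∫ x, g x ^ 2 ∂μ) + biasConst γ κ * (∫ x, g x ∂μ) ^ 2 := by
    nlinarith [sq_nonneg (∫ x, g x ∂μ)]
  rcases le_total ((∫ x, g x ∂μ) ^ 2) ((∫ x, g x ^ 2 ∂μ) * L) with h | h
  · rw [min_eq_left h]
    exact h1.trans (ENNReal.ofReal_le_ofReal hadd)
  · rw [min_eq_right h]
    have h2 := sq_integral_le (μ := μ) (g := g)
    have h3 := le_integral_sq (μ := μ) hgκ
    rcases le_or_gt L (8 * μ.real {x | g x ≠ 0}) with h4 | h4
    · refine hN.lintegral_coeffLoss_le_of_large hκ (by linarith) hL ?_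
      have : κ * b ^ 2 * L ≤ κ * b ^ 2 * (8 * μ.real {x | g x ≠ 0}) := by gcongr
      linarith
    -- Few expected points: m² ≤ qv ≤ vL, so the squared bias already has the required size.
    · refine h1.trans (ENNReal.ofReal_le_ofReal ?_)
      have : μ.real {x | g x ≠ 0} * ∫ x, g x ^ 2 ∂μ ≤ L * ∫ x, g x ^ 2 ∂μ := by
        gcongr
        linarith [measureReal_nonneg (μ := μ) (s := {x | g x ≠ 0})]
      have h5 : 0 ≤ (∫ x, g x ^ 2 ∂μ) * L := by positivity
      nlinarith

/-- Coefficients with few expected points: the threshold is passed only if there are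
`2 γ ln n` points in the support of `g`. -/
lemma lintegral_coeffLoss_le_of_small (hN : IsPoissonProcess P N μ) (hb : 0 ≤ b)
    (hg : ∀ᵐ x ∂μ, |g x| ≤ b) (hγ : 1 ≤ γ) (hL : 0 ≤ L)
    (hsmall : 8 * μ.real {x | g x ≠ 0} ≤ L) :
    ∫⁻ ω, ENNReal.ofReal (coeffLoss (γ * L) b g (∫ x, g x ∂μ) (N ω)) ∂P
      ≤ ENNReal.ofReal (2 * (∫ x, g x ∂μ) ^ 2
        + 14 * (b ^ 2 * μ.real {x | g x ≠ 0} * Real.exp (-(γ * L)))) := by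
  have hS := measurableSet_simpleFunc_ne_zero g
  set S := {x | g x ≠ 0} with hSdef
  set q := μ.real S with hq
  have hq0 : 0 ≤ q := measureReal_nonneg
  have i1 := ((hN.integrable_exp_realCount hS 2).sub (integrable_const 1)).const_mul
    (2 * (b ^ 2 * Real.exp (-(2 * (γ * L)))))
  refine lintegral_ofReal_le (fun ω => sq_nonneg _)
    (i1.add (integrable_const (2 * (∫ x, g x ∂μ) ^ 2))) ?_ ?_
  · filter_upwards [hN.ae_abs_pointSum_le hg] with ω hω
    have hw := pointSum_sq_nonneg (N ω) g
    have hu : 0 ≤ γ * L := mul_nonneg (by linarith) hL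
    have hthr := le_rawThreshold hu hb hw
    simp only [Pi.add_apply, Pi.sub_apply, coeffLoss]
    set K := realCount N S ω with hK
    have hK0 : 0 ≤ K := Nat.cast_nonneg _
    have hexp : K ^ 2 * Real.exp K ≤ Real.exp (2 * K) - 1 := natCast_sq_mul_exp_le _
    have hpos : 0 ≤ Real.exp (2 * K) - 1 := le_trans (by positivity) hexp
    have hpos' : 0 ≤ 2 * (b ^ 2 * Real.exp (-(2 * (γ * L)))) * (Real.exp (2 * K) - 1) := by
      positivity
    rcases le_or_gt (rawThreshold (γ * L) b (pointSum (N ω) fun x => g x ^ 2))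
      |pointSum (N ω) g| with h | h
    · rw [thresholdError_sq_of_le h]
      have h1 : pointSum (N ω) g ^ 2
          ≤ b ^ 2 * Real.exp (-(2 * (γ * L))) * (Real.exp (2 * K) - 1) := by
        have h2 : pointSum (N ω) g ^ 2 ≤ b ^ 2 * K ^ 2 := by
          rw [← sq_abs, ← mul_pow]
          gcongr
        refine h2.trans ?_
        rcases hb.eq_or_lt with hb0 | hb0
        · simp [← hb0]
        · have h3 : 2 * (γ * L) ≤ K := by
            have : b * (2 * (γ * L)) ≤ b * K := by linarith
            exact le_of_mul_le_mul_left this hb0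
          have h4 : 1 ≤ Real.exp (-(2 * (γ * L))) * Real.exp K := by
            rw [← Real.exp_add]
            exact Real.one_le_exp (by linarith)
          calc b ^ 2 * K ^ 2 ≤ b ^ 2 * K ^ 2 * (Real.exp (-(2 * (γ * L))) * Real.exp K) :=
                le_mul_of_one_le_right (by positivity) h4
            _ = b ^ 2 * Real.exp (-(2 * (γ * L))) * (K ^ 2 * Real.exp K) := by ring
            _ ≤ _ := by gcongr
      nlinarith [sq_nonneg (pointSum (N ω) g + ∫ x, g x ∂μ)]
    · have h2 := thresholdError_sq_le_of_lt (m := ∫ x, g x ∂μ) h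
      nlinarith [sq_nonneg (∫ x, g x ∂μ)]
  · rw [integral_add' i1 (integrable_const _), integral_const_mul,
      integral_sub' (hN.integrable_exp_realCount hS 2) (integrable_const _)]
    have hm := hN.mgf_realCount hS 2
    rw [mgf] at hm
    rw [hm]
    simp only [integral_const, probReal_univ, smul_eq_mul, one_mul]
    have he2 : Real.exp 2 ≤ 8 := by
      have h1 := Real.exp_one_lt_d9
      have h2 : Real.exp 2 = Real.exp 1 * Real.exp 1 := by rw [← Real.exp_add]; norm_num
      have := Real.exp_pos 1
      rw [h2]
      nlinarith
    have he3 : 1 ≤ Real.exp 2 := Real.one_le_exp (by norm_num)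
    -- Use e^y − 1 ≤ y e^y with y = q(e² − 1) ≤ 7q ≤ γL. The growth e^{γL} consumes half of the
    -- decay e^{−2γL}, and the factor q survives.
    have h1 : Real.exp (q * (Real.exp 2 - 1)) - 1 ≤ 7 * q * Real.exp (γ * L) := by
      have h2 : q * (Real.exp 2 - 1) ≤ 7 * q := by nlinarith
      have h3 : Real.exp (q * (Real.exp 2 - 1)) - 1
          ≤ q * (Real.exp 2 - 1) * Real.exp (q * (Real.exp 2 - 1)) := by
        have h4 := Real.add_one_le_exp (-(q * (Real.exp 2 - 1)))
        have h5 : Real.exp (-(q * (Real.exp 2 - 1))) * Real.exp (q * (Real.exp 2 - 1)) = 1 := by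
          rw [← Real.exp_add]; simp
        nlinarith [Real.exp_pos (q * (Real.exp 2 - 1))]
      have h6 : Real.exp (q * (Real.exp 2 - 1)) ≤ Real.exp (γ * L) := by
        apply Real.exp_le_exp.2
        nlinarith
      refine h3.trans ?_
      gcongr
    have h2 : Real.exp (-(2 * (γ * L))) * Real.exp (γ * L) = Real.exp (-(γ * L)) := by
      rw [← Real.exp_add]; ring_nf
    calc 2 * (b ^ 2 * Real.exp (-(2 * (γ * L)))) * (Real.exp (q * (Real.exp 2 - 1)) - 1)
          + 2 * (∫ x, g x ∂μ) ^ 2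
        ≤ 2 * (b ^ 2 * Real.exp (-(2 * (γ * L)))) * (7 * q * Real.exp (γ * L))
          + 2 * (∫ x, g x ∂μ) ^ 2 := by gcongr
      _ = 14 * (b ^ 2 * q * (Real.exp (-(2 * (γ * L))) * Real.exp (γ * L)))
          + 2 * (∫ x, g x ∂μ) ^ 2 := by ring
      _ = _ := by rw [h2]; ring

end IsPoissonProcess

/-- The constant in front of the exponentially small remainder of the risk. -/
def remainderConst (γ κ : ℝ) : ℝ :=
  3 * ((κ / 8 + γ) ^ 2 / (κ / 32)) + 4 / (κ / 32) + 14

lemma remainderConst_ge {γ κ : ℝ} (hκ : 0 < κ) : 14 ≤ remainderConst γ κ := by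
  rw [remainderConst]
  have : 0 ≤ 3 * ((κ / 8 + γ) ^ 2 / (κ / 32)) + 4 / (κ / 32) := by positivity
  linarith

namespace IsPoissonProcess

variable {Ω : Type*} [MeasurableSpace Ω] {P : Measure Ω} [IsProbabilityMeasure P]
  {N : Ω → Set ℝ} {μ : Measure ℝ} [IsFiniteMeasure μ] {g : SimpleFunc ℝ ℝ} {b κ γ γ' δ L : ℝ}

/-- Coefficients with many expected points that are small with respect to their standard
deviation: passing the threshold requires a large deviation. -/
lemma lintegral_coeffLoss_le_of_small_coeff (hN : IsPoissonProcess P N μ) (hb : 0 < b)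
    (hg : ∀ᵐ x ∂μ, |g x| ≤ b) (hκ : 0 < κ) (hγ' : 0 ≤ γ') (hγ : γ' ≤ γ)
    (hδ : Real.sqrt (2 * γ') + δ ≤ Real.sqrt (2 * γ)) (hL : 1 ≤ L)
    (hv : 0 < ∫ x, g x ^ 2 ∂μ) (hbig : κ * b ^ 2 * L ≤ 8 * ∫ x, g x ^ 2 ∂μ)
    (hm : |∫ x, g x ∂μ| ≤ δ * Real.sqrt ((∫ x, g x ^ 2 ∂μ) * L)) :
    ∫⁻ ω, ENNReal.ofReal (coeffLoss (γ * L) b g (∫ x, g x ∂μ) (N ω)) ∂P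
      ≤ ENNReal.ofReal (min ((∫ x, g x ∂μ) ^ 2)
          (2 * (∫ x, g x ^ 2 ∂μ) + biasConst γ κ * ((∫ x, g x ^ 2 ∂μ) * L))
        + remainderConst γ' κ * ((∫ x, g x ^ 2 ∂μ) * L * Real.exp (-(γ' * L)))) := by
  set v := ∫ x, g x ^ 2 ∂μ with hvdef
  set m := ∫ x, g x ∂μ with hmdef
  -- The two bad events: the sum deviates at level γ'L, or the empirical variance falls too low for
  -- the upper estimate to be guaranteed.
  set B₁ := {ω | Real.sqrt (2 * v * (γ' * L)) + b / 3 * (γ' * L) ≤ |pointSum (N ω) g - m|}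
  set B₂ := {ω | Real.sqrt (2 * (b ^ 2 * v) * (γ * L)) + b ^ 2 / 3 * (γ * L)
    ≤ v - pointSum (N ω) (fun x => g x ^ 2)}
  have hL0 : 0 ≤ L := by linarith
  have hu : 0 ≤ γ * L := mul_nonneg (hγ'.trans hγ) hL0
  have aZ := hN.aemeasurable_pointSum g
  have aV : AEMeasurable (fun ω => pointSum (N ω) (fun x => g x ^ 2)) P :=
    (hN.integrable_pointSum_sq g).aemeasurable
  -- Only null measurability is available: the point sums agree with measurable expressions in the
  -- counts off the null event of infinitely many points.
  have hB : NullMeasurableSet (B₁ ∪ B₂) P :=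
    (nullMeasurableSet_le aemeasurable_const
      (continuous_abs.measurable.comp_aemeasurable (aZ.sub_const m))).union
    (nullMeasurableSet_le aemeasurable_const (aV.const_sub v))
  have hPB : P.real (B₁ ∪ B₂) ≤ 3 * Real.exp (-(γ' * L)) := by
    have h1 := hN.bernstein_abs hb.le hg hv le_rfl (u := γ' * L) (by positivity)
    have h2 := hN.bernstein_sq hb hg hv hu
    have h3 : Real.exp (-(γ * L)) ≤ Real.exp (-(γ' * L)) := by
      apply Real.exp_le_exp.2
      nlinarith
    have h4 := measureReal_union_le (μ := P) B₁ B₂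
    linarith
  have hrem : ∫ ω in B₁ ∪ B₂, (pointSum (N ω) g - m) ^ 2 ∂P
      ≤ remainderConst γ' κ * (v * L * Real.exp (-(γ' * L))) := by
    -- Chosen so that 4τ = κ/8, which turns the lower bound on v into the one required by the
    -- truncated moment estimate.
    have hτ : 0 < κ / 32 := by positivity
    have h := hN.setIntegral_centered_sq_le_of_large hg hv hτ (γ := γ')
      (by linarith : 0 < L) (by linarith) (B₁ ∪ B₂)
    refine h.trans ?_
    have h1 : 4 * v / (κ / 32 * L) ≤ 4 / (κ / 32) * (v * L) := by
      rw [div_le_iff₀ (by positivity)]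
      have : 4 / (κ / 32) * (v * L) * (κ / 32 * L) = 4 * v * (L * L) := by field_simp
      rw [this]
      exact le_mul_of_one_le_right (by positivity) (one_le_mul_of_one_le_of_one_le hL hL)
    have h2 : 4 * (κ / 32) + γ' = κ / 8 + γ' := by ring
    rw [h2]
    calc (κ / 8 + γ') ^ 2 / (κ / 32) * v * L * P.real (B₁ ∪ B₂)
          + 4 * v / (κ / 32 * L) * Real.exp (-(γ' * L))
        ≤ (κ / 8 + γ') ^ 2 / (κ / 32) * v * L * (3 * Real.exp (-(γ' * L)))
          + 4 / (κ / 32) * (v * L) * Real.exp (-(γ' * L)) := by gcongr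
      _ ≤ _ := by
          rw [remainderConst]
          have : 0 ≤ v * L * Real.exp (-(γ' * L)) := by positivity
          linarith
  have key : ∀ ω, rawThreshold (γ * L) b (pointSum (N ω) fun x => g x ^ 2) ≤ |pointSum (N ω) g| →
      ω ∈ B₁ ∪ B₂ := by
    intro ω hω
    by_contra hnot
    rw [Set.mem_union, not_or] at hnot
    have hv2 := le_upperVar_of_sub_lt hu (pointSum_sq_nonneg (N ω) g) hv.le (not_le.1 hnot.2)
    exact hnot.1 (bernstein_le_of_rawThreshold_le hL0 hγ' hγ hδ hb.le hv2 hm hω)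
  have iB := (hN.integrable_centered_sq g).indicator₀ hB
  have eB := integral_indicator₀ (f := fun ω => (pointSum (N ω) g - m) ^ 2) hB
  -- The minimum is deterministic, so the domination of a killed coefficient, by m² or by 2(Z − m)²
  -- + 2η², may be chosen in advance. A kept one is always charged to the bad event.
  rcases min_choice (m ^ 2) (2 * v + biasConst γ κ * (v * L)) with h | h <;> rw [h]
  · refine lintegral_ofReal_le (fun ω => sq_nonneg _) (iB.add (integrable_const (m ^ 2)))
      (.of_forall fun ω => ?_) ?_
    · simp only [Pi.add_apply, coeffLoss]
      rcases le_or_gt (rawThreshold (γ * L) b (pointSum (N ω) fun x => g x ^ 2))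
        |pointSum (N ω) g| with h | h
      · rw [thresholdError_sq_of_le h, Set.indicator_of_mem (key ω h)]
        linarith [sq_nonneg m]
      · have h2 := thresholdError_sq_le_of_lt (m := m) h
        have h3 : 0 ≤ (B₁ ∪ B₂).indicator (fun ω => (pointSum (N ω) g - m) ^ 2) ω :=
          Set.indicator_nonneg (fun _ _ => sq_nonneg _) _
        linarith
    · rw [integral_add' iB (integrable_const _), eB]
      simp only [integral_const, probReal_univ, smul_eq_mul, one_mul]
      linarith
  · have i1 := (hN.integrable_centered_sq g).const_mul 2
    have i2 := (hN.integrable_pointSum_sq g).const_mul (16 * (γ * L))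
    refine lintegral_ofReal_le (fun ω => sq_nonneg _)
      (iB.add ((i1.add i2).add (integrable_const (34 * (γ * L) ^ 2 * b ^ 2))))
      (.of_forall fun ω => ?_) ?_
    · simp only [Pi.add_apply, coeffLoss]
      have hw := pointSum_sq_nonneg (N ω) g
      have h1 := rawThreshold_sq_le (b := b) hu hw
      have hp : 0 ≤ 16 * (γ * L) * pointSum (N ω) (fun x => g x ^ 2) := by positivity
      have hp' : 0 ≤ 34 * (γ * L) ^ 2 * b ^ 2 := by positivity
      have hp'' := sq_nonneg (pointSum (N ω) g - m)
      rcases le_or_gt (rawThreshold (γ * L) b (pointSum (N ω) fun x => g x ^ 2))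
        |pointSum (N ω) g| with h | h
      · rw [thresholdError_sq_of_le h, Set.indicator_of_mem (key ω h)]
        linarith
      · have h2 := thresholdError_sq_le_of_lt (m := m) h
        have h4 := sq_le_of_abs_lt (m := m) h
        have h3 : 0 ≤ (B₁ ∪ B₂).indicator (fun ω => (pointSum (N ω) g - m) ^ 2) ω :=
          Set.indicator_nonneg (fun _ _ => sq_nonneg _) _
        linarith
    · rw [integral_add' iB ((i1.add i2).add (integrable_const _)), eB,
        integral_add' (i1.add i2) (integrable_const _), integral_add' i1 i2, integral_const_mul,
        integral_const_mul, hN.integral_centered_sq, hN.integral_pointSum_of_sq]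
      simp only [integral_const, probReal_univ, smul_eq_mul, one_mul, biasConst]
      have : 34 * (γ * L) ^ 2 * b ^ 2 ≤ 272 * γ ^ 2 / κ * (v * L) := by
        have h4 : b ^ 2 * L ≤ 8 * v / κ := by
          rw [le_div_iff₀ hκ]
          linarith
        calc 34 * (γ * L) ^ 2 * b ^ 2 = 34 * γ ^ 2 * L * (b ^ 2 * L) := by ring
          _ ≤ 34 * γ ^ 2 * L * (8 * v / κ) := by gcongr
          _ = _ := by ring
      linarith

/-- The oracle inequality for one coefficient. -/
lemma lintegral_coeffLoss_le_oracle (hN : IsPoissonProcess P N μ) (hb : 0 ≤ b)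
    (hg : ∀ᵐ x ∂μ, |g x| ≤ b) (hκ : 0 < κ) (hgκ : ∀ x, g x ≠ 0 → κ * b ^ 2 ≤ g x ^ 2)
    (hγ' : 1 ≤ γ') (hγ : γ' ≤ γ) (hδ0 : 0 ≤ δ)
    (hδ : Real.sqrt (2 * γ') + δ ≤ Real.sqrt (2 * γ)) (hL : 1 ≤ L) (hδL : 1 ≤ δ ^ 2 * L) :
    ∫⁻ ω, ENNReal.ofReal (coeffLoss (γ * L) b g (∫ x, g x ∂μ) (N ω)) ∂P
      ≤ ENNReal.ofReal
        ((3 + biasConst γ κ) * min ((∫ x, g x ∂μ) ^ 2) ((∫ x, g x ^ 2 ∂μ) * L)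
          + remainderConst γ' κ *
            (b ^ 2 * μ.real {x | g x ≠ 0} * L * Real.exp (-(γ' * L)))) := by
  have hv0 : 0 ≤ ∫ x, g x ^ 2 ∂μ := integral_nonneg fun x => sq_nonneg _
  have hK := one_le_biasConst hκ (hγ'.trans hγ)
  have hR := remainderConst_ge (γ := γ') hκ
  have hmq := sq_integral_le (μ := μ) (g := g)
  have hvq := integral_sq_le hg
  have hqv := le_integral_sq (μ := μ) hgκ
  have hadd := hN.lintegral_coeffLoss_le_add (g := g) (γ * L) b
  have hq0 : 0 ≤ μ.real {x | g x ≠ 0} := measureReal_nonneg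
  set q := μ.real {x | g x ≠ 0}
  set v := ∫ x, g x ^ 2 ∂μ with hvdef
  set m := ∫ x, g x ∂μ with hmdef
  have hm0 := sq_nonneg m
  have hvL : v ≤ v * L := le_mul_of_one_le_right hv0 hL
  have hrem0 : 0 ≤ b ^ 2 * q * L * Real.exp (-(γ' * L)) := by positivity
  -- If v = 0, then m = 0 by Cauchy–Schwarz and nothing is left to estimate; Bernstein's bound needs
  -- v > 0.
  rcases hv0.eq_or_lt with hv | hv
  · refine hadd.trans (ENNReal.ofReal_le_ofReal ?_)
    have : m ^ 2 = 0 := le_antisymm (by rw [← hv] at hmq; linarith) hm0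
    rw [← hv, this]
    have : 0 ≤ remainderConst γ' κ * (b ^ 2 * q * L * Real.exp (-(γ' * L))) := by positivity
    simpa using this
  rcases le_or_gt (8 * q) L with hsm | hbig
  · refine (hN.lintegral_coeffLoss_le_of_small hb hg (hγ'.trans hγ) (by linarith) hsm).trans
      (ENNReal.ofReal_le_ofReal ?_)
    have h1 : m ^ 2 ≤ v * L := by nlinarith
    rw [min_eq_left h1]
    have h2 : Real.exp (-(γ * L)) ≤ L * Real.exp (-(γ' * L)) := by
      have : Real.exp (-(γ * L)) ≤ Real.exp (-(γ' * L)) := by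
        apply Real.exp_le_exp.2
        nlinarith
      nlinarith [Real.exp_pos (-(γ' * L))]
    have h3 : 14 * (b ^ 2 * q * Real.exp (-(γ * L)))
        ≤ remainderConst γ' κ * (b ^ 2 * q * L * Real.exp (-(γ' * L))) := by
      rw [mul_assoc (b ^ 2 * q) L]
      gcongr
    nlinarith
  · have hb0 : 0 < b := by
      refine hb.lt_of_ne fun h => ?_
      rw [← h] at hvq
      simp at hvq
      linarith
    have hbig' : κ * b ^ 2 * L ≤ 8 * v := by
      have : κ * b ^ 2 * L ≤ κ * b ^ 2 * (8 * q) := by gcongr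
      linarith
    have hr' : 0 ≤ remainderConst γ' κ * (b ^ 2 * q * L * Real.exp (-(γ' * L))) := by positivity
    -- Since δ²L ≥ 1, a large coefficient has v ≤ m²; also v ≤ vL, so the variance is absorbed in
    -- the minimum whichever side is smaller.
    rcases le_or_gt (δ ^ 2 * (v * L)) (m ^ 2) with hm | hm
    · have h1 : v ≤ m ^ 2 := by nlinarith
      rcases le_total (m ^ 2) (v * L) with h | h
      · rw [min_eq_left h]
        refine hadd.trans (ENNReal.ofReal_le_ofReal ?_)
        nlinarith
      · rw [min_eq_right h]
        refine (hN.lintegral_coeffLoss_le_of_large hκ (by linarith) (by linarith) hbig').trans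
          (ENNReal.ofReal_le_ofReal ?_)
        nlinarith
    · have hm' : |m| ≤ δ * Real.sqrt (v * L) := by
        apply abs_le_of_sq_le_sq _ (by positivity)
        rw [mul_pow, Real.sq_sqrt (by positivity)]
        exact hm.le
      refine (hN.lintegral_coeffLoss_le_of_small_coeff hb0 hg hκ (by linarith) hγ hδ hL hv hbig'
        hm').trans (ENNReal.ofReal_le_ofReal (add_le_add ?_ ?_))
      · rcases le_total (m ^ 2) (v * L) with h | h
        · rw [min_eq_left h]
          exact (min_le_left _ _).trans (by nlinarith)
        · rw [min_eq_right h]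
          exact (min_le_right _ _).trans (by nlinarith)
      · gcongr

end IsPoissonProcess

/-! ### Piecewise constant functions -/

/-- The value depends only on how x compares with each breakpoint, and there are finitely many such
patterns; finite range and measurability both follow. Equality is recorded because values at
breakpoints are arbitrary. -/
lemma IsPiecewiseConstant.exists_eq_comp {g : ℝ → ℝ} (hg : IsPiecewiseConstant g) :
    ∃ (S : Finset ℝ) (h : (S → Prop × Prop) → ℝ),
      g = h ∘ fun x s => ((s : ℝ) < x, (s : ℝ) = x) := by
  obtain ⟨S, hS⟩ := hg
  have key : ∀ x y : ℝ, x ≤ y → (fun s : S => (((s : ℝ) < x, (s : ℝ) = x) : Prop × Prop)) =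
      (fun s : S => ((s : ℝ) < y, (s : ℝ) = y)) → g x = g y := by
    intro x y hxy h
    rcases hxy.eq_or_lt with rfl | hlt
    · rfl
    refine hS x y hxy fun s hs hmem => ?_
    have h1 := congrFun h ⟨s, hs⟩
    simp only [Prod.mk.injEq, eq_iff_iff] at h1
    obtain ⟨h2, h3⟩ := h1
    rcases hmem.1.eq_or_lt with h4 | h4
    · exact hlt.ne (h4.trans (h3.1 h4.symm))
    · rcases hmem.2.eq_or_lt with h5 | h5
      · exact h4.ne (h3.2 h5).symm
      · exact absurd (h2.2 h5) (not_lt.2 h4.le)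
  have hf : Function.FactorsThrough g
      (fun (x : ℝ) (s : S) => (((s : ℝ) < x, (s : ℝ) = x) : Prop × Prop)) := by
    intro x y h
    rcases le_total x y with hxy | hxy
    · exact key x y hxy h
    · exact (key y x hxy h.symm).symm
  exact ⟨S, Function.extend _ g (fun _ => (0 : ℝ)), (hf.extend_comp fun _ => (0 : ℝ)).symm⟩

lemma IsPiecewiseConstant.finite_range {g : ℝ → ℝ} (hg : IsPiecewiseConstant g) :
    (Set.range g).Finite := by
  obtain ⟨S, h, rfl⟩ := hg.exists_eq_comp
  exact (Set.finite_range h).subset (Set.range_comp_subset_range _ _)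

lemma IsPiecewiseConstant.measurable {g : ℝ → ℝ} (hg : IsPiecewiseConstant g) :
    Measurable g := by
  obtain ⟨S, h, rfl⟩ := hg.exists_eq_comp
  refine (measurable_of_countable h).comp (measurable_pi_lambda _ fun s => ?_)
  exact (measurableSet_setOfPred.1 measurableSet_Ioi).prodMk
    (measurableSet_setOfPred.1 (measurableSet_eq_fun measurable_const measurable_id))

lemma isPiecewiseConstant_phi : IsPiecewiseConstant phi := by
  refine ⟨{0, 1}, fun x y hxy h => ?_⟩
  have h0 := h 0 (by simp)
  have h1 := h 1 (by simp)
  simp only [Set.mem_Icc, not_and, not_le] at h0 h1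
  simp only [phi, Set.indicator, Set.mem_Icc]
  have : (0 ≤ x ∧ x ≤ 1) ↔ (0 ≤ y ∧ y ≤ 1) := by
    constructor
    · rintro ⟨a, b⟩
      refine ⟨a.trans hxy, ?_⟩
      by_contra! hc
      exact absurd (h1 b) (not_lt.2 hc.le)
    · rintro ⟨a, b⟩
      refine ⟨?_, hxy.trans b⟩
      by_contra! hc
      exact absurd (h0 hc.le) (not_lt.2 a)
  simp only [this]

lemma hasCompactSupport_phi : HasCompactSupport phi :=
  HasCompactSupport.intro isCompact_Icc fun _ hx => Set.indicator_of_notMem hx _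

/-- A compactly supported piecewise constant function is bounded, with bounded support, and is
bounded below on its support. -/
lemma IsPiecewiseConstant.exists_bounds {g : ℝ → ℝ} (hg : IsPiecewiseConstant g)
    (hc : HasCompactSupport g) : ∃ T M ε : ℝ, 0 < ε ∧ ε ≤ 1 ∧ 1 ≤ M ∧ 0 ≤ T ∧
      ∀ x, g x ≠ 0 → |x| ≤ T ∧ |g x| ≤ M ∧ ε ≤ |g x| := by
  obtain ⟨T, hT⟩ := hc.isCompact.isBounded.subset_closedBall 0
  have hT' : ∀ x, g x ≠ 0 → |x| ≤ T := fun x hx => by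
    simpa using hT (subset_tsupport g hx)
  have hfin : ((Set.range g) \ {0}).Finite := hg.finite_range.subset Set.sdiff_subset
  obtain ⟨M, hM⟩ : ∃ M, ∀ v ∈ Set.range g, |v| ≤ M := by
    obtain ⟨M, hM⟩ := (hg.finite_range.image abs).bddAbove
    exact ⟨M, fun v hv => hM (Set.mem_image_of_mem _ hv)⟩
  -- Bounding the inverses of the nonzero values also covers g = 0, which has no such value.
  obtain ⟨E, hE⟩ : ∃ E, ∀ v ∈ Set.range g \ {0}, |v|⁻¹ ≤ E := by
    obtain ⟨M, hM⟩ := (hfin.image fun v => |v|⁻¹).bddAbove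
    exact ⟨M, fun v hv => hM (Set.mem_image_of_mem _ hv)⟩
  refine ⟨max T 0, max M 1, (max E 1)⁻¹, by positivity, ?_, le_max_right _ _, le_max_right _ _,
    fun x hx => ⟨(hT' x hx).trans (le_max_left _ _), (hM _ ⟨x, rfl⟩).trans (le_max_left _ _), ?_⟩⟩
  · exact inv_le_one_of_one_le₀ (le_max_right _ _)
  · have h := (hE (g x) ⟨⟨x, rfl⟩, hx⟩).trans (le_max_left E 1)
    rw [inv_le_comm₀ (by positivity) (by positivity)]
    exact h

/-! ### The analysis functions -/

lemma dilate_zero (g : ℝ → ℝ) (k : ℤ) : dilate g 0 k = translate g k := by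
  ext x
  simp [dilate, translate]

lemma rpow_half_sq (j : ℤ) : ((2 : ℝ) ^ ((j : ℝ) / 2)) ^ 2 = (2 : ℝ) ^ j := by
  rw [← Real.rpow_natCast, ← Real.rpow_mul (by norm_num), ← Real.rpow_intCast]
  norm_num

namespace BiorthogonalWavelets

variable (W : BiorthogonalWavelets)

/-- The unscaled function of which the analysis function is a dilate. -/
def mother (l : WaveletIndex) : ℝ → ℝ := if l.1.1 = -1 then phi else W.ψ

/-- Level −1 carries undilated translates, so its true scale is that of level 0; this is the reason
for the maximum in the later bounds. -/
lemma analysis_eq_dilate (l : WaveletIndex) :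
    W.analysis l = dilate (W.mother l) (max l.1.1 0) l.1.2 := by
  rw [analysis, mother]
  split_ifs with h
  · rw [h, ← dilate_zero]
    rfl
  · have : max l.1.1 0 = l.1.1 := by have := l.2; omega
    rw [this]

lemma isPiecewiseConstant_mother (l : WaveletIndex) : IsPiecewiseConstant (W.mother l) := by
  rw [mother]
  split_ifs
  · exact isPiecewiseConstant_phi
  · exact W.piecewise_ψ

lemma finite_range_analysis (l : WaveletIndex) : (Set.range (W.analysis l)).Finite := by
  rw [analysis_eq_dilate]
  refine ((W.isPiecewiseConstant_mother l).finite_range.image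
    ((2 : ℝ) ^ (((max l.1.1 0 : ℤ) : ℝ) / 2) * ·)).subset ?_
  rintro _ ⟨x, rfl⟩
  exact ⟨_, ⟨_, rfl⟩, rfl⟩

lemma measurable_analysis (l : WaveletIndex) : Measurable (W.analysis l) := by
  rw [analysis_eq_dilate]
  exact ((W.isPiecewiseConstant_mother l).measurable.comp (by fun_prop)).const_mul _

/-- The analysis function as a simple function. -/
def analysisSimple (l : WaveletIndex) : SimpleFunc ℝ ℝ where
  toFun := W.analysis l
  measurableSet_fiber' v := W.measurable_analysis l (measurableSet_singleton v)
  finite_range' := W.finite_range_analysis l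

@[simp] lemma coe_analysisSimple (l : WaveletIndex) : ⇑(W.analysisSimple l) = W.analysis l := rfl

/-- Uniform bounds on the size and the support of the analysis functions. -/
lemma exists_analysis_bounds : ∃ T M ε : ℝ, 0 < ε ∧ ε ≤ 1 ∧ 1 ≤ M ∧ 0 ≤ T ∧
    ∀ l x, W.analysis l x ≠ 0 → |(2 : ℝ) ^ (max l.1.1 0) * x - l.1.2| ≤ T ∧
      W.analysis l x ^ 2 ≤ 2 ^ (max l.1.1 0) * M ^ 2 ∧
      2 ^ (max l.1.1 0) * ε ^ 2 ≤ W.analysis l x ^ 2 := by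
  obtain ⟨T₁, M₁, ε₁, h1, h1', h1'', h1''', H1⟩ :=
    isPiecewiseConstant_phi.exists_bounds hasCompactSupport_phi
  obtain ⟨T₂, M₂, ε₂, h2, h2', h2'', h2''', H2⟩ := W.piecewise_ψ.exists_bounds W.compact_ψ
  refine ⟨max T₁ T₂, max M₁ M₂, min ε₁ ε₂, lt_min h1 h2, (min_le_left _ _).trans h1',
    h1''.trans (le_max_left _ _), h1'''.trans (le_max_left _ _), fun l x hx => ?_⟩
  have H : ∀ y, W.mother l y ≠ 0 →
      |y| ≤ max T₁ T₂ ∧ |W.mother l y| ≤ max M₁ M₂ ∧ min ε₁ ε₂ ≤ |W.mother l y| := by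
    intro y
    rw [mother]
    split_ifs
    · intro hy
      obtain ⟨a, b, c⟩ := H1 y hy
      exact ⟨a.trans (le_max_left _ _), b.trans (le_max_left _ _), (min_le_left _ _).trans c⟩
    · intro hy
      obtain ⟨a, b, c⟩ := H2 y hy
      exact ⟨a.trans (le_max_right _ _), b.trans (le_max_right _ _), (min_le_right _ _).trans c⟩
  rw [analysis_eq_dilate, dilate] at hx ⊢
  obtain ⟨a, b, c⟩ := H _ (right_ne_zero_of_mul hx)
  rw [mul_pow, rpow_half_sq, ← sq_abs (W.mother l _)]
  have hε : 0 < min ε₁ ε₂ := lt_min h1 h2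
  exact ⟨a, by gcongr, by gcongr⟩

lemma supNorm_nonneg (g : ℝ → ℝ) : 0 ≤ supNorm g := ENNReal.toReal_nonneg

lemma abs_le_of_sq_le {T M ε : ℝ} (hM : 1 ≤ M)
    (H : ∀ l x, W.analysis l x ≠ 0 → |(2 : ℝ) ^ (max l.1.1 0) * x - l.1.2| ≤ T ∧
      W.analysis l x ^ 2 ≤ 2 ^ (max l.1.1 0) * M ^ 2 ∧
      2 ^ (max l.1.1 0) * ε ^ 2 ≤ W.analysis l x ^ 2) (l : WaveletIndex) (x : ℝ) :
    |W.analysis l x| ≤ Real.sqrt (2 ^ (max l.1.1 0)) * M := by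
  by_cases hx : W.analysis l x = 0
  · rw [hx, abs_zero]
    positivity
  · have h : W.analysis l x ^ 2 ≤ 2 ^ (max l.1.1 0) * M ^ 2 := (H l x hx).2.1
    apply abs_le_of_sq_le_sq _ (by positivity)
    rwa [mul_pow, Real.sq_sqrt (by positivity)]

lemma eLpNorm_analysis_ne_top (l : WaveletIndex) : eLpNorm (W.analysis l) ∞ volume ≠ ∞ := by
  obtain ⟨T, M, ε, -, -, hM, -, H⟩ := W.exists_analysis_bounds
  exact (memLp_top_of_bound (W.measurable_analysis l).aestronglyMeasurable _
    (.of_forall fun x => W.abs_le_of_sq_le hM H l x)).eLpNorm_ne_top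

lemma ae_abs_analysis_le (l : WaveletIndex) :
    ∀ᵐ x, |W.analysis l x| ≤ supNorm (W.analysis l) := by
  have h := ae_le_eLpNormEssSup (f := W.analysis l) (μ := volume)
  have h1 := W.eLpNorm_analysis_ne_top l
  rw [eLpNorm_exponent_top] at h1
  filter_upwards [h] with x hx
  rw [supNorm, eLpNorm_exponent_top]
  have := ENNReal.toReal_mono h1 hx
  simpa using this

lemma supNorm_sq_le {T M ε : ℝ} (hM : 1 ≤ M)
    (H : ∀ l x, W.analysis l x ≠ 0 → |(2 : ℝ) ^ (max l.1.1 0) * x - l.1.2| ≤ T ∧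
      W.analysis l x ^ 2 ≤ 2 ^ (max l.1.1 0) * M ^ 2 ∧
      2 ^ (max l.1.1 0) * ε ^ 2 ≤ W.analysis l x ^ 2) (l : WaveletIndex) :
    supNorm (W.analysis l) ^ 2 ≤ 2 ^ (max l.1.1 0) * M ^ 2 := by
  have h : supNorm (W.analysis l) ≤ Real.sqrt (2 ^ (max l.1.1 0)) * M := by
    rw [supNorm]
    refine ENNReal.toReal_le_of_le_ofReal (by positivity) ?_
    rw [eLpNorm_exponent_top]
    refine eLpNormEssSup_le_of_ae_bound (.of_forall fun x => ?_)
    exact W.abs_le_of_sq_le hM H l x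
  calc supNorm (W.analysis l) ^ 2 ≤ (Real.sqrt (2 ^ (max l.1.1 0)) * M) ^ 2 := by
        gcongr
        exact supNorm_nonneg _
    _ = _ := by rw [mul_pow, Real.sq_sqrt (by positivity)]

/-- On its support, an analysis function is comparable to its sup norm. -/
lemma exists_sq_lower_bound : ∃ κ : ℝ, 0 < κ ∧ ∀ l x, W.analysis l x ≠ 0 →
    κ * supNorm (W.analysis l) ^ 2 ≤ W.analysis l x ^ 2 := by
  obtain ⟨T, M, ε, hε, -, hM, -, H⟩ := W.exists_analysis_bounds
  refine ⟨ε ^ 2 / M ^ 2, by positivity, fun l x hx => ?_⟩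
  calc ε ^ 2 / M ^ 2 * supNorm (W.analysis l) ^ 2
      ≤ ε ^ 2 / M ^ 2 * (2 ^ (max l.1.1 0) * M ^ 2) := by
        gcongr
        exact W.supNorm_sq_le hM H l
    _ = 2 ^ (max l.1.1 0) * ε ^ 2 := by field_simp
    _ ≤ _ := (H l x hx).2.2

end BiorthogonalWavelets

/-! ### Overlap of the supports -/

lemma int_near_subset (y T : ℝ) :
    {k : ℤ | |y - k| ≤ T} ⊆ (Finset.Icc ⌈y - T⌉ ⌊y + T⌋ : Finset ℤ) := by
  intro k hk
  have := abs_le.1 (Set.mem_ofPred_eq ▸ hk)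
  rw [Finset.coe_Icc, Set.mem_Icc, Int.ceil_le, Int.le_floor]
  constructor <;> linarith [this.1, this.2]

lemma card_int_near_le {T : ℝ} (hT : 0 ≤ T) (y : ℝ) :
    ((Finset.Icc ⌈y - T⌉ ⌊y + T⌋).card : ℝ) ≤ 2 * T + 1 := by
  rw [Int.card_Icc]
  have h1 := Int.le_ceil (y - T)
  have h2 := Int.floor_le (y + T)
  rcases le_total 0 (⌊y + T⌋ + 1 - ⌈y - T⌉) with h | h
  · have : (((⌊y + T⌋ + 1 - ⌈y - T⌉).toNat : ℤ) : ℝ) = ((⌊y + T⌋ + 1 - ⌈y - T⌉ : ℤ) : ℝ) := by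
      rw [Int.toNat_of_nonneg h]
    rw [Int.cast_natCast] at this
    rw [this]
    push_cast
    linarith
  · rw [Int.toNat_of_nonpos h]
    simp
    linarith

/-- Each x lies in at most 2T + 1 of the sets. After exchanging sum and integral, all the translates
at one scale cost only the total mass. -/
lemma tsum_measure_near_le (μ : Measure ℝ) {T : ℝ} (hT : 0 ≤ T) (a : ℝ) :
    ∑' k : ℤ, μ {x | |a * x - k| ≤ T} ≤ ENNReal.ofReal (2 * T + 1) * μ Set.univ := by
  have hm : ∀ k : ℤ, MeasurableSet {x : ℝ | |a * x - k| ≤ T} := fun k =>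
    measurableSet_le (by fun_prop) measurable_const
  have h1 : ∀ k : ℤ, μ {x | |a * x - k| ≤ T}
      = ∫⁻ x, {x | |a * x - k| ≤ T}.indicator (fun _ => (1 : ℝ≥0∞)) x ∂μ := fun k => by
    rw [lintegral_indicator_const (hm k), one_mul]
  simp_rw [h1]
  rw [← lintegral_tsum fun k => (measurable_const.indicator (hm k)).aemeasurable,
    ← lintegral_const]
  refine lintegral_mono fun x => ?_
  rw [tsum_eq_sum (s := Finset.Icc ⌈a * x - T⌉ ⌊a * x + T⌋)]
  · calc ∑ k ∈ Finset.Icc ⌈a * x - T⌉ ⌊a * x + T⌋,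
          {x : ℝ | |a * x - k| ≤ T}.indicator (fun _ => (1 : ℝ≥0∞)) x
        ≤ ∑ k ∈ Finset.Icc ⌈a * x - T⌉ ⌊a * x + T⌋, (1 : ℝ≥0∞) :=
          Finset.sum_le_sum fun k _ => Set.indicator_le_self' (by simp) _
      _ = ENNReal.ofReal ((Finset.Icc ⌈a * x - T⌉ ⌊a * x + T⌋).card : ℝ) := by simp
      _ ≤ _ := ENNReal.ofReal_le_ofReal (card_int_near_le hT _)
  · intro k hk
    refine Set.indicator_of_notMem (fun h => hk ?_) _
    exact_mod_cast int_near_subset (a * x) T h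

namespace BiorthogonalWavelets

variable (W : BiorthogonalWavelets)

/-- The sum of `‖φ_λ‖_∞² μ(supp φ_λ)` over the levels up to `j₀` is of order `2 ^ j₀ μ(ℝ)`. -/
lemma exists_tsum_supNorm_sq_le : ∃ C : ℝ, 0 < C ∧ ∀ (μ : Measure ℝ) [IsFiniteMeasure μ] (j₀ : ℤ),
    ∑' l : levelsUpTo j₀, ENNReal.ofReal
        (supNorm (W.analysis l) ^ 2 * μ.real {x | W.analysis l x ≠ 0})
      ≤ ENNReal.ofReal (C * 2 ^ j₀ * μ.real Set.univ) := by
  obtain ⟨T, M, ε, -, -, hM, hT, H⟩ := W.exists_analysis_bounds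
  refine ⟨4 * M ^ 2 * (2 * T + 1), by positivity, fun μ _ j₀ => ?_⟩
  -- Levels are counted downwards, i = j₀ − j, so that 2^j = 2^{j₀}2^{−i} is summable over all
  -- natural i.
  let F : ℕ × ℤ → ℝ≥0∞ := fun p =>
    ENNReal.ofReal (2 * M ^ 2 * 2 ^ j₀ * (1 / 2) ^ p.1) *
      μ {x | |(2 : ℝ) ^ (max (j₀ - p.1) 0) * x - p.2| ≤ T}
  let e : levelsUpTo j₀ → ℕ × ℤ := fun l => ((j₀ - l.1.1.1).toNat, l.1.1.2)
  have hj : ∀ l : levelsUpTo j₀, j₀ - ((j₀ - l.1.1.1).toNat : ℤ) = l.1.1.1 := fun l => by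
    have : l.1.1.1 ≤ j₀ := l.2
    omega
  have he : Function.Injective e := by
    intro l l' h
    simp only [e, Prod.mk.injEq] at h
    have h1 := hj l
    rw [h.1, hj l'] at h1
    exact Subtype.ext (Subtype.ext (Prod.ext h1.symm h.2))
  have hle : ∀ l : levelsUpTo j₀, ENNReal.ofReal
      (supNorm (W.analysis l) ^ 2 * μ.real {x | W.analysis l x ≠ 0}) ≤ F (e l) := by
    intro l
    simp only [F, e, hj l]
    rw [ENNReal.ofReal_mul (sq_nonneg _)]
    gcongr ?_ * ?_
    · refine ENNReal.ofReal_le_ofReal ((W.supNorm_sq_le hM H l).trans ?_)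
      -- The factor 2 is needed only at level −1, whose scale is 1 instead of 1/2.
      have h1 : (2 : ℝ) ^ (max l.1.1.1 0) ≤ 2 * 2 ^ l.1.1.1 := by
        have h3 : (2 : ℝ) * 2 ^ l.1.1.1 = 2 ^ (l.1.1.1 + 1) := by
          rw [zpow_add₀ (by norm_num)]
          ring
        rw [h3]
        apply zpow_le_zpow_right₀ (by norm_num)
        have := l.1.2
        omega
      have h2 : (2 : ℝ) ^ l.1.1.1 = 2 ^ j₀ * (1 / 2) ^ (j₀ - l.1.1.1).toNat := by
        rw [one_div, inv_pow, ← zpow_natCast, ← zpow_neg, ← zpow_add₀ (by norm_num)]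
        congr 1
        have := hj l
        omega
      calc (2 : ℝ) ^ (max l.1.1.1 0) * M ^ 2 ≤ 2 * 2 ^ l.1.1.1 * M ^ 2 := by gcongr
        _ = _ := by rw [h2]; ring
    · rw [measureReal_def, ENNReal.ofReal_toReal (measure_ne_top _ _)]
      exact measure_mono fun x hx => (H l x hx).1
  calc ∑' l : levelsUpTo j₀, ENNReal.ofReal
        (supNorm (W.analysis l) ^ 2 * μ.real {x | W.analysis l x ≠ 0})
      ≤ ∑' l : levelsUpTo j₀, F (e l) := ENNReal.tsum_le_tsum hle
    _ ≤ ∑' p, F p := ENNReal.tsum_comp_le_tsum_of_injective he F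
    _ = ∑' i : ℕ, ∑' k : ℤ, F (i, k) := ENNReal.tsum_prod'
    _ ≤ ∑' i : ℕ, ENNReal.ofReal (2 * M ^ 2 * 2 ^ j₀ * (1 / 2) ^ i) *
          (ENNReal.ofReal (2 * T + 1) * μ Set.univ) := by
        refine ENNReal.tsum_le_tsum fun i => ?_
        simp only [F]
        rw [ENNReal.tsum_mul_left]
        gcongr
        exact tsum_measure_near_le μ hT _
    _ = ENNReal.ofReal (2 * M ^ 2 * 2 ^ j₀ * 2) * (ENNReal.ofReal (2 * T + 1) * μ Set.univ) := by
        rw [ENNReal.tsum_mul_right, ← ENNReal.ofReal_tsum_of_nonneg (fun i => by positivity)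
          (summable_geometric_two.mul_left _), tsum_mul_left, tsum_geometric_two]
    _ = _ := by
        rw [← ofReal_measureReal (measure_ne_top μ Set.univ), ← ENNReal.ofReal_mul (by positivity),
          ← ENNReal.ofReal_mul (by positivity)]
        congr 1
        ring

end BiorthogonalWavelets

/-! ### Coefficients of the estimator -/

lemma MemLp.dilate {g : ℝ → ℝ} {p : ℝ≥0∞} (hg : MemLp g p volume) (j k : ℤ) :
    MemLp (dilate g j k) p volume := by
  have ha : (2 : ℝ) ^ j ≠ 0 := by positivity
  have hmap : Measure.map (fun x : ℝ => (2 : ℝ) ^ j * x - k) volume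
      = ENNReal.ofReal |((2 : ℝ) ^ j)⁻¹| • volume := by
    have : (fun x : ℝ => (2 : ℝ) ^ j * x - k)
        = (fun x => x - (k : ℝ)) ∘ fun x => (2 : ℝ) ^ j * x := rfl
    rw [this, ← Measure.map_map (by fun_prop) (by fun_prop), Real.map_volume_mul_left ha,
      Measure.map_smul, map_sub_right_eq_self]
  have h := hg.smul_measure (c := ENNReal.ofReal |((2 : ℝ) ^ j)⁻¹|) ENNReal.ofReal_ne_top
  rw [← hmap] at h
  exact (h.comp_of_map (by fun_prop)).const_mul _

namespace BiorthogonalWavelets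

variable (W : BiorthogonalWavelets)

lemma memLp_reconstruction (l : WaveletIndex) : MemLp (W.reconstruction l) 2 volume := by
  rw [reconstruction]
  split_ifs
  · rw [← dilate_zero]
    exact MemLp.dilate W.memLp_φt _ _
  · exact MemLp.dilate W.memLp_ψt _ _

lemma memLp_mother (l : WaveletIndex) : MemLp (W.mother l) 2 volume := by
  have hpc := W.isPiecewiseConstant_mother l
  have hc : HasCompactSupport (W.mother l) := by
    rw [mother]
    split_ifs
    · exact hasCompactSupport_phi
    · exact W.compact_ψ
  obtain ⟨T, M, ε, -, -, hM, -, H⟩ := hpc.exists_bounds hc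
  have hb : ∀ x, ‖W.mother l x‖ ≤ M := fun x => by
    by_cases hx : W.mother l x = 0
    · rw [hx, norm_zero]
      linarith
    · exact (H x hx).2.1
  have h1 : MemLp (W.mother l) ∞ volume :=
    memLp_top_of_bound hpc.measurable.aestronglyMeasurable M (.of_forall hb)
  have h2 : W.mother l = (tsupport (W.mother l)).indicator (W.mother l) := by
    rw [Set.indicator_eq_self.2]
    exact subset_tsupport _
  rw [h2, memLp_indicator_iff_restrict (isClosed_tsupport _).measurableSet]
  have : IsFiniteMeasure (volume.restrict (tsupport (W.mother l))) :=
    ⟨by rw [Measure.restrict_apply_univ]; exact hc.isCompact.measure_lt_top⟩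
  exact (h1.restrict _).mono_exponent le_top

lemma memLp_analysis (l : WaveletIndex) : MemLp (W.analysis l) 2 volume := by
  rw [analysis_eq_dilate]
  exact MemLp.dilate (W.memLp_mother l) _ _

/-- Biorthogonality of the reconstruction and the analysis functions. -/
lemma integral_reconstruction_mul_analysis (l l' : WaveletIndex) :
    ∫ x, W.reconstruction l x * W.analysis l' x = if l = l' then 1 else 0 := by
  have hl := l.2
  have hl' := l'.2
  simp_rw [mul_comm (W.reconstruction l _)]
  rw [reconstruction, analysis]
  by_cases h : l.1.1 = -1 <;> by_cases h' : l'.1.1 = -1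
  · rw [if_pos h, if_pos h', W.biorth_φ_φt]
    simp [Subtype.ext_iff, Prod.ext_iff, h, h', eq_comm]
  · rw [if_pos h, if_neg h', W.biorth_ψ_φt _ _ _ (by omega), if_neg]
    rintro rfl
    exact h' h
  · rw [if_neg h, if_pos h', W.biorth_φ_ψt _ _ _ (by omega), if_neg]
    rintro rfl
    exact h h'
  · rw [if_neg h, if_neg h', W.biorth_ψ_ψt _ _ _ _ (by omega) (by omega)]
    simp [Subtype.ext_iff, Prod.ext_iff, eq_comm]

lemma finite_analysis_ne_zero (j₀ : ℤ) (x : ℝ) :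
    {l : levelsUpTo j₀ | W.analysis l x ≠ 0}.Finite := by
  obtain ⟨T, M, ε, -, -, hM, hT, H⟩ := W.exists_analysis_bounds
  have hfin : (⋃ j ∈ (Finset.Icc (-1) j₀ : Finset ℤ), (fun k : ℤ => (j, k)) ''
      ((Finset.Icc ⌈(2 : ℝ) ^ (max j 0) * x - T⌉ ⌊(2 : ℝ) ^ (max j 0) * x + T⌋ : Finset ℤ) :
        Set ℤ)).Finite :=
    Set.Finite.biUnion (Finset.finite_toSet _) fun j _ => (Finset.finite_toSet _).image _
  refine (hfin.preimage (f := fun l : levelsUpTo j₀ => l.1.1)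
    (Subtype.val_injective.comp Subtype.val_injective).injOn).subset ?_
  intro l hl
  have h1 : l.1.1.1 ≤ j₀ := l.2
  have h2 := l.1.2
  simp only [Set.mem_preimage, Set.mem_iUnion]
  refine ⟨l.1.1.1, by rw [Finset.mem_Icc]; exact ⟨h2, h1⟩, l.1.1.2, ?_, rfl⟩
  exact int_near_subset _ T (H l x hl).1

/-- Each observed point meets finitely many supports up to level j₀. Elsewhere β̂ = 0, and both
branches of the thresholding then return 0. -/
lemma finite_betaTilde_ne_zero (γ : ℝ) (n : ℕ) (j₀ : ℤ) {N : Set ℝ} (hN : N.Finite) :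
    {l : levelsUpTo j₀ | W.betaTilde γ n N l ≠ 0}.Finite := by
  refine (hN.biUnion fun x _ => W.finite_analysis_ne_zero j₀ x).subset fun l hl => ?_
  simp only [Set.mem_iUnion]
  by_contra! hcon
  apply hl
  have h0 : W.betaHat n N l = 0 := by
    rw [betaHat, pointSum]
    have : ∀ T : N, W.analysis l T = 0 := fun T => by
      by_contra h
      exact hcon T T.2 h
    simp [this]
  simp [betaTilde, h0]

/-- For a finite point set the estimator is a finite combination of reconstruction functions, so
biorthogonality applies term by term without any convergence question. -/
lemma coeff_estimator_sub (γ : ℝ) (n : ℕ) (j₀ : ℤ) {N : Set ℝ} (hN : N.Finite) {f : ℝ → ℝ}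
    (hf : MemLp f 2 volume) (l : WaveletIndex) :
    W.coeff (fun x => W.estimator γ n (levelsUpTo j₀) N x - f x) l
      = (levelsUpTo j₀).indicator (W.betaTilde γ n N) l - W.coeff f l := by
  classical
  set s := (W.finite_betaTilde_ne_zero γ n j₀ hN).toFinset with hs
  have hsupp : ∀ l' : levelsUpTo j₀, l' ∉ s → W.betaTilde γ n N l' = 0 := fun l' h => by
    simpa [hs] using h
  have hest : ∀ x, W.estimator γ n (levelsUpTo j₀) N x
      = ∑ l' ∈ s, W.betaTilde γ n N l' * W.reconstruction l' x := fun x => by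
    rw [estimator, tsum_eq_sum]
    intro l' h
    rw [hsupp l' h, zero_mul]
  have i1 : ∀ l' : WaveletIndex,
      Integrable (fun x => W.reconstruction l' x * W.analysis l x) volume := fun l' =>
    (W.memLp_reconstruction l').integrable_mul (W.memLp_analysis l)
  have i2 : Integrable (fun x => f x * W.analysis l x) volume :=
    hf.integrable_mul (W.memLp_analysis l)
  have i3 : ∀ l' ∈ s, Integrable (fun x => W.betaTilde γ n N l' *
      (W.reconstruction l' x * W.analysis l x)) volume := fun l' _ => (i1 l').const_mul _
  simp only [coeff, hest, sub_mul, Finset.sum_mul, mul_assoc]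
  rw [integral_sub (integrable_finsetSum _ i3) i2, integral_finsetSum _ i3]
  congr 1
  simp_rw [integral_const_mul, W.integral_reconstruction_mul_analysis]
  by_cases hl : l ∈ levelsUpTo j₀
  · rw [Set.indicator_of_mem hl, Finset.sum_eq_single ⟨l, hl⟩]
    · simp
    · intro l' _ hne
      rw [if_neg fun h => hne (Subtype.ext h), mul_zero]
    · intro h
      rw [hsupp _ h, zero_mul]
  · rw [Set.indicator_of_notMem hl]
    refine Finset.sum_eq_zero fun l' _ => ?_
    rw [if_neg fun h : (l' : WaveletIndex) = l => hl (h ▸ l'.2), mul_zero]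

lemma normSq_estimator_sub (γ : ℝ) (n : ℕ) (j₀ : ℤ) {N : Set ℝ} (hN : N.Finite) {f : ℝ → ℝ}
    (hf : MemLp f 2 volume) :
    W.normSq (fun x => W.estimator γ n (levelsUpTo j₀) N x - f x)
      = ∑' l : levelsUpTo j₀, ENNReal.ofReal ((W.betaTilde γ n N l - W.coeff f l) ^ 2)
        + ∑' l : ((levelsUpTo j₀)ᶜ : Set WaveletIndex), ENNReal.ofReal (W.coeff f l ^ 2) := by
  rw [normSq]
  simp_rw [W.coeff_estimator_sub γ n j₀ hN hf]
  rw [← Summable.tsum_add_tsum_compl (s := levelsUpTo j₀) ENNReal.summable ENNReal.summable]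
  congr 1
  · refine tsum_congr fun l => ?_
    rw [Set.indicator_of_mem l.2]
  · refine tsum_congr fun l => ?_
    rw [Set.indicator_of_notMem l.2, zero_sub, neg_sq]

/-! ### Normalisation -/

lemma betaHat_eq (n : ℕ) (N : Set ℝ) (l : WaveletIndex) :
    W.betaHat n N l = pointSum N (W.analysis l) / n := by
  rw [betaHat]
  ring

lemma varHat_eq (n : ℕ) (N : Set ℝ) (l : WaveletIndex) :
    W.varHat n N l = pointSum N (fun x => W.analysis l x ^ 2) / (n : ℝ) ^ 2 := by
  rw [varHat, pointSum, pointSum, tsum_div_const]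

/-- The threshold scales like 1/n under normalisation, as β̂ does, so the choice to keep or kill can
be studied for the raw point sums. -/
lemma threshold_eq (γ : ℝ) {n : ℕ} (hn : 0 < n) (N : Set ℝ) (l : WaveletIndex) :
    W.threshold γ n N l = rawThreshold (γ * Real.log n) (supNorm (W.analysis l))
      (pointSum N fun x => W.analysis l x ^ 2) / n := by
  have hn' : (0 : ℝ) < n := by exact_mod_cast hn
  have h1 : W.varTilde γ n N l = upperVar (γ * Real.log n) (supNorm (W.analysis l))
      (pointSum N fun x => W.analysis l x ^ 2) / (n : ℝ) ^ 2 := by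
    rw [varTilde, varHat_eq, upperVar]
    set w := pointSum N fun x => W.analysis l x ^ 2
    set b := supNorm (W.analysis l)
    have : 2 * γ * Real.log n * (w / (n : ℝ) ^ 2) * (b ^ 2 / (n : ℝ) ^ 2)
        = 2 * (γ * Real.log n) * w * b ^ 2 / ((n : ℝ) ^ 2) ^ 2 := by field_simp
    rw [this, Real.sqrt_div' _ (by positivity), Real.sqrt_sq (by positivity)]
    ring
  rw [threshold, h1, rawThreshold, ← mul_div_assoc, Real.sqrt_div' _ (by positivity),
    Real.sqrt_sq hn'.le, add_div]
  congr 1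
  · ring_nf
  · field_simp

lemma betaTilde_sub_sq (γ : ℝ) {n : ℕ} (hn : 0 < n) (N : Set ℝ) (l : WaveletIndex) (m : ℝ) :
    (W.betaTilde γ n N l - m / n) ^ 2 = 1 / (n : ℝ) ^ 2 *
      coeffLoss (γ * Real.log n) (supNorm (W.analysis l)) (W.analysis l) m N := by
  have hn' : (0 : ℝ) < n := by exact_mod_cast hn
  rw [betaTilde, coeffLoss, thresholdError, threshold_eq W γ hn, betaHat_eq, abs_div,
    abs_of_pos hn']
  simp only [div_le_div_iff_of_pos_right hn']
  split_ifs
  · field_simp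
  · simp
    field_simp

end BiorthogonalWavelets

/-- The mean measure `n f(x) dx`. -/
def intensity (n : ℕ) (f : ℝ → ℝ) : Measure ℝ :=
  volume.withDensity fun x => ENNReal.ofReal (n * f x)

/-! ### The mean measure and the sample sizes -/

section Intensity

variable {f : ℝ → ℝ} (n : ℕ)

lemma integral_intensity (hf : MemLp f 1 volume) (hf0 : ∀ᵐ x ∂(volume : Measure ℝ), 0 ≤ f x)
    (h : ℝ → ℝ) : ∫ x, h x ∂(intensity n f) = n * ∫ x, h x * f x := by
  rw [intensity, integral_withDensity_eq_integral_toReal_smul₀, ← integral_const_mul]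
  · refine integral_congr_ae ?_
    filter_upwards [hf0] with x hx
    rw [ENNReal.toReal_ofReal (by positivity), smul_eq_mul]
    ring
  · exact (hf.1.aemeasurable.const_mul _).ennreal_ofReal
  · exact .of_forall fun x => ENNReal.ofReal_lt_top

lemma isFiniteMeasure_intensity (hf : MemLp f 1 volume) : IsFiniteMeasure (intensity n f) :=
  isFiniteMeasure_withDensity_ofReal ((memLp_one_iff_integrable.1 hf).const_mul _).2

lemma intensity_real_univ (hf : MemLp f 1 volume)
    (hf0 : ∀ᵐ x ∂(volume : Measure ℝ), 0 ≤ f x) :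
    (intensity n f).real Set.univ = n * ∫ x, |f x| := by
  have := integral_intensity n hf hf0 (fun _ => 1)
  rw [integral_const, smul_eq_mul, mul_one] at this
  rw [this]
  congr 1
  refine integral_congr_ae ?_
  filter_upwards [hf0] with x hx
  rw [abs_of_nonneg hx, one_mul]

end Intensity

open Filter in
/-- The sample sizes for which the remainder is negligible. -/
lemma exists_sampleSize {c γ' δ : ℝ} (c' : ℝ) (hc : c < γ') (hδ : 0 < δ) :
    ∃ (n₀ : ℕ) (A : ℝ), 0 ≤ A ∧
      (∀ n : ℕ, n₀ ≤ n → 1 ≤ Real.log n ∧ 1 ≤ δ ^ 2 * Real.log n ∧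
        (n : ℝ) ^ c * Real.log n ^ c' * (Real.log n * Real.exp (-(γ' * Real.log n))) ≤ A) ∧
      ∀ n : ℕ, n < n₀ → (n : ℝ) ^ c * Real.log n ^ c' ≤ A := by
  have hlog : Tendsto (fun n : ℕ => Real.log n) atTop atTop :=
    Real.tendsto_log_atTop.comp tendsto_natCast_atTop_atTop
  -- In terms of L = ln n, the quantity to bound is L^{c'+1} e^{−(γ'−c)L}.
  have h1 := (tendsto_rpow_mul_exp_neg_mul_atTop_nhds_zero (c' + 1) (γ' - c)
    (by linarith)).comp hlog
  have h2 := h1.eventually_le_const (show (0 : ℝ) < 1 by norm_num)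
  have h3 := hlog.eventually_ge_atTop (max 1 (1 / δ ^ 2))
  obtain ⟨n₀, hn₀⟩ := eventually_atTop.1 ((h2.and h3).and (eventually_ge_atTop 1))
  obtain ⟨A, hA⟩ := ((Set.finite_lt_nat n₀).image
    fun n : ℕ => (n : ℝ) ^ c * Real.log n ^ c').bddAbove
  refine ⟨n₀, max A 1, by positivity, fun n hn => ?_, fun n hn =>
    (hA (Set.mem_image_of_mem _ hn)).trans (le_max_left _ _)⟩
  obtain ⟨⟨a, b⟩, hn1⟩ := hn₀ n hn
  have hL1 : 1 ≤ Real.log n := (le_max_left _ _).trans b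
  have hL2 : 1 / δ ^ 2 ≤ Real.log n := (le_max_right _ _).trans b
  refine ⟨hL1, ?_, le_trans (le_of_eq ?_) (a.trans (le_max_right _ _))⟩
  · rw [div_le_iff₀ (by positivity)] at hL2
    linarith
  · have hn0 : (0 : ℝ) < n := by exact_mod_cast hn1
    simp only [Function.comp_apply]
    rw [Real.rpow_def_of_pos hn0, Real.rpow_add (by linarith), Real.rpow_one,
      show -(γ' - c) * Real.log n = Real.log n * c + -(γ' * Real.log n) by ring, Real.exp_add]
    ring

/-! ### From one coefficient to the full risk -/

namespace BiorthogonalWavelets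

variable (W : BiorthogonalWavelets) {f : ℝ → ℝ} {n : ℕ}

lemma coeff_eq (hn : 0 < n) (hf : MemLp f 1 volume)
    (hf0 : ∀ᵐ x ∂(volume : Measure ℝ), 0 ≤ f x) (l : WaveletIndex) :
    W.coeff f l = (∫ x, W.analysisSimple l x ∂(intensity n f)) / n := by
  have hn' : (n : ℝ) ≠ 0 := by exact_mod_cast hn.ne'
  rw [integral_intensity n hf hf0, coeff]
  simp only [coe_analysisSimple, mul_comm (f _)]
  field_simp

lemma variance_eq (hn : 0 < n) (hf : MemLp f 1 volume)
    (hf0 : ∀ᵐ x ∂(volume : Measure ℝ), 0 ≤ f x) (l : WaveletIndex) :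
    W.variance f n l = (∫ x, W.analysisSimple l x ^ 2 ∂(intensity n f)) / (n : ℝ) ^ 2 := by
  have hn' : (n : ℝ) ≠ 0 := by exact_mod_cast hn.ne'
  rw [integral_intensity n hf hf0 (fun x => W.analysisSimple l x ^ 2), variance, sigmaSq]
  simp only [coe_analysisSimple]
  field_simp

/-- Bounds for the single coefficients add up to a bound for the risk. -/
lemma risk_le_of_coeffLoss_le {C : ℝ} {j₀ : ℤ}
    (hC : ∀ (μ : Measure ℝ) [IsFiniteMeasure μ],
      ∑' l : levelsUpTo j₀, ENNReal.ofReal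
        (supNorm (W.analysis l) ^ 2 * μ.real {x | W.analysis l x ≠ 0})
      ≤ ENNReal.ofReal (C * 2 ^ j₀ * μ.real Set.univ))
    (hn : 0 < n) (hf : MemLp f 1 volume) (hf2 : MemLp f 2 volume)
    (hf0 : ∀ᵐ x ∂(volume : Measure ℝ), 0 ≤ f x)
    {Ω : Type*} [MeasurableSpace Ω] {P : Measure Ω} [IsProbabilityMeasure P] {N : Ω → Set ℝ}
    (hN : IsPoissonProcess P N (intensity n f)) {γ a r : ℝ} (ha : 1 ≤ a) (hr : 0 ≤ r)
    (hloss : ∀ l, ∫⁻ ω, ENNReal.ofReal (coeffLoss (γ * Real.log n) (supNorm (W.analysis l))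
        (W.analysisSimple l) (∫ x, W.analysisSimple l x ∂(intensity n f)) (N ω)) ∂P
      ≤ ENNReal.ofReal (a * min ((∫ x, W.analysisSimple l x ∂(intensity n f)) ^ 2)
          ((∫ x, W.analysisSimple l x ^ 2 ∂(intensity n f)) * Real.log n)
        + r * (supNorm (W.analysis l) ^ 2 *
          (intensity n f).real {x | W.analysis l x ≠ 0}))) :
    W.risk γ n (levelsUpTo j₀) f P N
      ≤ ENNReal.ofReal a * W.oracleBound n (levelsUpTo j₀) f
        + ENNReal.ofReal (r * (C * 2 ^ j₀ * ∫ x, |f x|) / n) := by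
  have hfin := isFiniteMeasure_intensity n hf
  have hn' : (0 : ℝ) < n := by exact_mod_cast hn
  have hterm : ∀ l ω, ENNReal.ofReal ((W.betaTilde γ n (N ω) l - W.coeff f l) ^ 2)
      = ENNReal.ofReal (1 / (n : ℝ) ^ 2) * ENNReal.ofReal (coeffLoss (γ * Real.log n)
        (supNorm (W.analysis l)) (W.analysisSimple l)
        (∫ x, W.analysisSimple l x ∂(intensity n f)) (N ω)) := fun l ω => by
    rw [W.coeff_eq hn hf hf0, W.betaTilde_sub_sq γ hn, ENNReal.ofReal_mul (by positivity),
      coe_analysisSimple]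
  have hmeas : ∀ l, AEMeasurable (fun ω => ENNReal.ofReal (coeffLoss (γ * Real.log n)
      (supNorm (W.analysis l)) (W.analysisSimple l)
      (∫ x, W.analysisSimple l x ∂(intensity n f)) (N ω))) P := fun l =>
    (hN.aemeasurable_coeffLoss (W.analysisSimple l) _ _ _).ennreal_ofReal
  have hone : ∀ l, ∫⁻ ω, ENNReal.ofReal ((W.betaTilde γ n (N ω) l - W.coeff f l) ^ 2) ∂P
      ≤ ENNReal.ofReal a *
          ENNReal.ofReal (min (W.coeff f l ^ 2) (W.variance f n l * Real.log n))
        + ENNReal.ofReal (r / (n : ℝ) ^ 2) * ENNReal.ofReal (supNorm (W.analysis l) ^ 2 *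
          (intensity n f).real {x | W.analysis l x ≠ 0}) := fun l => by
    simp_rw [hterm l]
    rw [lintegral_const_mul'' _ (hmeas l)]
    have hv : 0 ≤ ∫ x, W.analysisSimple l x ^ 2 ∂(intensity n f) :=
      integral_nonneg fun x => sq_nonneg _
    have hL : 0 ≤ Real.log n := Real.log_natCast_nonneg n
    have hmin : min (W.coeff f l ^ 2) (W.variance f n l * Real.log n)
        = min ((∫ x, W.analysisSimple l x ∂(intensity n f)) ^ 2)
          ((∫ x, W.analysisSimple l x ^ 2 ∂(intensity n f)) * Real.log n) / (n : ℝ) ^ 2 := by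
      rw [W.coeff_eq hn hf hf0, W.variance_eq hn hf hf0, ← min_div_div_right (by positivity),
        div_pow, div_mul_eq_mul_div]
    refine (mul_le_mul_right (hloss l) _).trans (le_of_eq ?_)
    rw [hmin, ← ENNReal.ofReal_mul (by positivity), ← ENNReal.ofReal_mul (by linarith),
      ← ENNReal.ofReal_mul (by positivity), ← ENNReal.ofReal_add (by positivity) (by positivity)]
    congr 1
    ring
  have hmeas' : ∀ l : levelsUpTo j₀, AEMeasurable
      (fun ω => ENNReal.ofReal ((W.betaTilde γ n (N ω) l - W.coeff f l) ^ 2)) P := fun l => by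
    simp_rw [hterm]
    exact (hmeas l).const_mul _
  have hrisk : W.risk γ n (levelsUpTo j₀) f P N
      = ∑' l : levelsUpTo j₀,
          ∫⁻ ω, ENNReal.ofReal ((W.betaTilde γ n (N ω) l - W.coeff f l) ^ 2) ∂P
        + ∑' l : ((levelsUpTo j₀)ᶜ : Set WaveletIndex), ENNReal.ofReal (W.coeff f l ^ 2) := by
    have h1 : ∀ᵐ ω ∂P, W.normSq (fun x => W.estimator γ n (levelsUpTo j₀) (N ω) x - f x)
        = ∑' l : levelsUpTo j₀, ENNReal.ofReal ((W.betaTilde γ n (N ω) l - W.coeff f l) ^ 2)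
          + ∑' l : ((levelsUpTo j₀)ᶜ : Set WaveletIndex), ENNReal.ofReal (W.coeff f l ^ 2) := by
      filter_upwards [hN.ae_finite] with ω hω
      exact W.normSq_estimator_sub γ n j₀ hω hf2
    rw [risk, lintegral_congr_ae h1, lintegral_add_right _ measurable_const, lintegral_const,
      measure_univ, mul_one, lintegral_tsum hmeas']
  have ha' : 1 ≤ ENNReal.ofReal a := by
    rw [← ENNReal.ofReal_one]
    exact ENNReal.ofReal_le_ofReal ha
  have hsum := hC (intensity n f)
  rw [intensity_real_univ n hf hf0] at hsum
  rw [hrisk, oracleBound, mul_add]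
  calc _ ≤ ∑' l : levelsUpTo j₀, (ENNReal.ofReal a *
          ENNReal.ofReal (min (W.coeff f l ^ 2) (W.variance f n l * Real.log n))
        + ENNReal.ofReal (r / (n : ℝ) ^ 2) * ENNReal.ofReal (supNorm (W.analysis l) ^ 2 *
          (intensity n f).real {x | W.analysis l x ≠ 0}))
        + ENNReal.ofReal a * ∑' l : ((levelsUpTo j₀)ᶜ : Set WaveletIndex),
          ENNReal.ofReal (W.coeff f l ^ 2) :=
        add_le_add (ENNReal.tsum_le_tsum fun l => hone l) (le_mul_of_one_le_left' ha')
    _ = ENNReal.ofReal a * ∑' l : levelsUpTo j₀,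
          ENNReal.ofReal (min (W.coeff f l ^ 2) (W.variance f n l * Real.log n))
        + ENNReal.ofReal a * ∑' l : ((levelsUpTo j₀)ᶜ : Set WaveletIndex),
          ENNReal.ofReal (W.coeff f l ^ 2)
        + ENNReal.ofReal (r / (n : ℝ) ^ 2) * ∑' l : levelsUpTo j₀,
          ENNReal.ofReal (supNorm (W.analysis l) ^ 2 *
            (intensity n f).real {x | W.analysis l x ≠ 0}) := by
        rw [ENNReal.tsum_add, ENNReal.tsum_mul_left, ENNReal.tsum_mul_left]
        ring
    _ ≤ _ := by
        -- The total mass n‖f‖₁ of the mean measure cancels one of the two factors 1/n.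
        refine add_le_add le_rfl ((mul_le_mul_right hsum _).trans (le_of_eq ?_))
        rw [← ENNReal.ofReal_mul (by positivity)]
        congr 1
        field_simp

end BiorthogonalWavelets

end PoissonWavelet

end

-- The order of quantifiers encodes the dependence of the constants, R being the L¹ norm. For n = 1
-- and c' ≠ 0, `Real.log 1 = 0` makes the power vanish, so no j₀ qualifies.
open PoissonWavelet BiorthogonalWavelets in
theorem theorem2 (W : PoissonWavelet.BiorthogonalWavelets) (γ : ℝ) :
    ∃ C₁ : ℝ, 0 < C₁ ∧
      ∀ c c' R : ℝ, 1 ≤ c → c < γ →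
        ∃ C₂ : ℝ, 0 < C₂ ∧
          ∀ (n : ℕ) (j₀ : ℤ), 0 < n →
            (2 : ℝ) ^ j₀ ≤ (n : ℝ) ^ c * Real.log n ^ c' →
            (n : ℝ) ^ c * Real.log n ^ c' < (2 : ℝ) ^ (j₀ + 1) →
            ∀ f : ℝ → ℝ, MemLp f 1 volume → MemLp f 2 volume →
              (∀ᵐ x ∂(volume : Measure ℝ), 0 ≤ f x) → ∫ x, |f x| = R →
              ∀ {Ω : Type*} [MeasurableSpace Ω] (P : Measure Ω) [IsProbabilityMeasure P]
                (N : Ω → Set ℝ),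
                PoissonWavelet.IsPoissonProcess P N
                  (volume.withDensity (fun x => ENNReal.ofReal (n * f x))) →
                W.risk γ n (PoissonWavelet.levelsUpTo j₀) f P N ≤
                  ENNReal.ofReal C₁ *
                      W.oracleBound n (PoissonWavelet.levelsUpTo j₀) f
                    + ENNReal.ofReal (C₂ / n) := by
  by_cases hγ : 1 < γ
  swap
  · exact ⟨1, one_pos, fun c c' R h1 h2 => absurd (h1.trans_lt h2) hγ⟩
  obtain ⟨κ, hκ, hlow⟩ := W.exists_sq_lower_bound
  obtain ⟨C, hC, hsum⟩ := W.exists_tsum_supNorm_sq_le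
  have hK := one_le_biasConst hκ hγ.le
  refine ⟨3 + biasConst γ κ, by linarith, fun c c' R h1c hcγ => ?_⟩
  -- The room between γ' and γ absorbs the means of small coefficients; the room between c and γ'
  -- beats the growth of 2^{j₀}. Since γ' depends on c, it may enter only C₂.
  obtain ⟨γ', hcγ', hγ'γ⟩ := exists_between hcγ
  have hδ : 0 < Real.sqrt (2 * γ) - Real.sqrt (2 * γ') :=
    sub_pos.2 (Real.sqrt_lt_sqrt (by linarith) (by linarith))
  obtain ⟨n₀, A, hA, hlarge, hsmall⟩ := exists_sampleSize c' hcγ' hδ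
  have hK2 := remainderConst_ge (γ := γ') hκ
  -- Here R is still an arbitrary real, hence the absolute value; the 1 keeps the constant positive
  -- when R = 0.
  refine ⟨(3 + remainderConst γ' κ) * (C * A * |R|) + 1, by positivity,
    fun n j₀ hn hj _ f hf hf2 hf0 hR Ω _ P _ N hN => ?_⟩
  have hN' : IsPoissonProcess P N (intensity n f) := hN
  have hfin := isFiniteMeasure_intensity n hf
  have hn' : (0 : ℝ) < n := by exact_mod_cast hn
  have hL : 0 ≤ Real.log n := Real.log_natCast_nonneg n
  have hR0 : 0 ≤ R := hR ▸ integral_nonneg fun x => abs_nonneg _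
  have hbound : ∀ l, ∀ᵐ x ∂(intensity n f), |W.analysisSimple l x| ≤ supNorm (W.analysis l) :=
    fun l => (withDensity_absolutelyContinuous _ _).ae_le (W.ae_abs_analysis_le l)
  have hCAR : 0 ≤ C * A * |R| := by positivity
  suffices h : ∃ r, 0 ≤ r ∧ r * (C * 2 ^ j₀ * R) ≤ (3 + remainderConst γ' κ) * (C * A * |R|) ∧
      ∀ l, ∫⁻ ω, ENNReal.ofReal (coeffLoss (γ * Real.log n) (supNorm (W.analysis l))
        (W.analysisSimple l) (∫ x, W.analysisSimple l x ∂(intensity n f)) (N ω)) ∂P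
      ≤ ENNReal.ofReal ((3 + biasConst γ κ) *
          min ((∫ x, W.analysisSimple l x ∂(intensity n f)) ^ 2)
          ((∫ x, W.analysisSimple l x ^ 2 ∂(intensity n f)) * Real.log n)
        + r * (supNorm (W.analysis l) ^ 2 *
          (intensity n f).real {x | W.analysis l x ≠ 0})) by
    obtain ⟨r, hr, hrC, hloss⟩ := h
    refine (W.risk_le_of_coeffLoss_le (fun μ _ => hsum μ j₀) hn hf hf2 hf0 hN' (by linarith) hr
      hloss).trans (add_le_add le_rfl (ENNReal.ofReal_le_ofReal ?_))
    rw [hR]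
    gcongr
    linarith
  rcases lt_or_ge n n₀ with hnn | hnn
  -- Small n: the remainder 3v is at most 3b²q, and 2^{j₀} is bounded by A.
  · refine ⟨3, by norm_num, ?_, fun l => ?_⟩
    · have h2 : C * 2 ^ j₀ * R ≤ C * A * |R| := by
        gcongr
        · exact hj.trans (hsmall n hnn)
        · exact le_abs_self R
      nlinarith
    · refine (hN'.lintegral_coeffLoss_le hκ (hlow l) hγ.le hL).trans
        (ENNReal.ofReal_le_ofReal ?_)
      have h2 := integral_sq_le (hbound l)
      have h3 : 0 ≤ min ((∫ x, W.analysisSimple l x ∂(intensity n f)) ^ 2)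
          ((∫ x, W.analysisSimple l x ^ 2 ∂(intensity n f)) * Real.log n) :=
        le_min (sq_nonneg _) (mul_nonneg (integral_nonneg fun x => sq_nonneg _) hL)
      rw [coe_analysisSimple] at h2 h3 ⊢
      linarith
  · obtain ⟨hL1, hδL, hdecay⟩ := hlarge n hnn
    refine ⟨remainderConst γ' κ * (Real.log n * Real.exp (-(γ' * Real.log n))), by positivity,
      ?_, fun l => ?_⟩
    · have h2 : 2 ^ j₀ * (Real.log n * Real.exp (-(γ' * Real.log n))) ≤ A :=
        le_trans (by gcongr) hdecay
      calc remainderConst γ' κ * (Real.log n * Real.exp (-(γ' * Real.log n))) * (C * 2 ^ j₀ * R)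
          = remainderConst γ' κ *
              (C * (2 ^ j₀ * (Real.log n * Real.exp (-(γ' * Real.log n)))) * R) := by ring
        _ ≤ remainderConst γ' κ * (C * A * |R|) := by
            gcongr
            exact le_abs_self R
        _ ≤ _ := by linarith
    · refine (hN'.lintegral_coeffLoss_le_oracle (supNorm_nonneg _) (hbound l) hκ (hlow l)
        (by linarith) hγ'γ.le hδ.le (by linarith) hL1 hδL).trans (le_of_eq ?_)
      rw [coe_analysisSimple]
      congr 1
      ring
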